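/- Let $\mathcal M=\langle M,\in,\mathcal C\rangle$ be a transitive model (in an ambient universe $V$ of set theory) of Gödel–Bernays set theory $\mathrm{GB}$ without choice, with $M$ its domain of sets and $\mathcal C$ its domain of classes; transitivity means that every element of a member of $M$ or of $\mathcal C$ lies in $M$. Let $\mathcal S=\langle\mathbb P,\mathcal G,\mathcal F\rangle$ be a class symmetric system in $\mathcal M$. That is: - $\mathbb P=\langle P,\le\rangle$ is a preorder with a weakest element and $P,{\le}\in\mathcal C$. - $\mathcal G=\{\pi_a\mid a\in\operatorname{dom}C_{\mathcal G}\}$ is a group of automorphisms of $\mathbb P$ coded by a class $C_{\mathcal G}\subseteq M\times P^2$ in $\mathcal C$, where $\pi_a=\{\langle p,q\rangle\mid\langle a,p,q\rangle\in C_{\mathcal G}\}$ is an automorphism of $\mathbb P$ for each $a\in\operatorname{dom}C_{\mathcal G}$. - $\mathcal F$ is a normal filter of subgroups of $\mathcal G$ with a base coded by a class $C_{\mathcal F}\subseteq M\times\operatorname{dom}C_{\mathcal G}$ in $\mathcal C$. Precisely, for $a\in\operatorname{dom}C_{\mathcal F}$ the sets $H_a=\{\pi_d\mid\langle a,d\rangle\in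 C_{\mathcal F}\}$ are subgroups of $\mathcal G$; some $H_b$ equals $\mathcal G$; for all $a,b$ there is $c$ with $H_c\subseteq H_a\cap H_b$; for all $a$ and all $\pi\in\mathcal G$ there is $c$ with $H_c\subseteq\pi H_a\pi^{-1}$ (here $a,b,c\in\operatorname{dom}C_{\mathcal F}$). A subgroup $H$ of $\mathcal G$ belongs to $\mathcal F$ iff $H=\{\pi_b\mid b\in C\}$ for some $C\in\mathcal C$ with $C\subseteq\operatorname{dom}C_{\mathcal G}$, and $H_a\subseteq H$ for some $a\in\operatorname{dom}C_{\mathcal F}$. A $\mathbb P$-name is a set or class all of whose elements are pairs $\langle\dot y,p\rangle$ with, recursively, $\dot y$ a $\mathbb P$-name and $p\in P$; put $\pi(\dot x)=\{\langle\pi(\dot y),\pi(p)\rangle\mid\langle\dot y,p\rangle\in\dot x\}$. An $\mathcal S$-name is a $\mathbb P$-name $\dot x$ such that $\{\pi\in\mathcal G\mid\pi(\dot x)=\dot x\}\in\mathcal F$ and, recursively, every $\dot y\in\operatorname{dom}(\dot x)$ is an $\mathcal S$-name. A filter $G\subseteq P$ (in $V$) is $\mathcal S$-generic if it meets every dense $D\subseteq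 P$ with $D\in\mathcal C$ and $\{\pi\in\mathcal G\mid\pi[D]=D\}\in\mathcal F$. Let $\dot x^G=\{\dot y^G\mid(\exists p\in G)\,\langle\dot y,p\rangle\in\dot x\}$ and let $\mathcal M[G]_{\mathcal S}=\langle M[G]_{\mathcal S},\in,\mathcal C[G]_{\mathcal S}\rangle$, where $M[G]_{\mathcal S}=\{\dot x^G\mid\dot x\in M\text{ an }\mathcal S\text{-name}\}$ and $\mathcal C[G]_{\mathcal S}=\{\dot X^G\mid\dot X\in\mathcal C\text{ an }\mathcal S\text{-name}\}$. A two-sorted structure satisfies second-order class comprehension if for every second-order formula $\varphi(x,\vec X)$ (quantifiers over sets and over classes are allowed; $x$ is the only free set variable) and all classes $\vec A$ of the structure, there is a class $B$ of the structure with $(\forall x)(x\in B\leftrightarrow\varphi(x,\vec A))$. **Statement.** If $\mathcal M$ satisfies second-order class comprehension, then for every $\mathcal S$-generic filter $G\subseteq P$, the symmetric extension $\mathcal M[G]_{\mathcal S}$ also satisfies second-order class comprehension. -/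

import Mathlib

namespace ClassForcing

universe u

/-! ## Second-order formulas and models of class theory

Everything takes place in an ambient universe of set theory, `ZFSet`. -/

/-- Formulas of the two-sorted language of class theory (second-order formulas) with free set
variables indexed by `Fin n` and free class variables indexed by `Fin m`. The quantifiers bind the
last set (respectively class) variable. -/
inductive ClassFormula : ℕ → ℕ → Type
  | mem {n m : ℕ} (i j : Fin n) : ClassFormula n m
  | eq {n m : ℕ} (i j : Fin n) : ClassFormula n m
  | memClass {n m : ℕ} (i : Fin n) (J : Fin m) : ClassFormula n m
  | eqClass {n m : ℕ} (I J : Fin m) : ClassFormula n m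
  | and {n m : ℕ} (φ ψ : ClassFormula n m) : ClassFormula n m
  | not {n m : ℕ} (φ : ClassFormula n m) : ClassFormula n m
  | exSet {n m : ℕ} (φ : ClassFormula (n + 1) m) : ClassFormula n m
  | exClass {n m : ℕ} (φ : ClassFormula n (m + 1)) : ClassFormula n m

/-- A two-sorted structure `⟨M, ∈, 𝒞⟩` with a domain `M` of sets and a domain `𝒞` of classes, whose
elementhood relation is that of the ambient universe. -/
structure ClassModel where
  sets : Set ZFSet.{u}
  classes : Set ZFSet.{u}

/-- Satisfaction `𝓜 ⊨ φ(x, X)`. -/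
def ClassFormula.Sat (𝓜 : ClassModel.{u}) : {n m : ℕ} → ClassFormula n m →
    (Fin n → ZFSet.{u}) → (Fin m → ZFSet.{u}) → Prop
  | _, _, .mem i j, x, _ => x i ∈ x j
  | _, _, .eq i j, x, _ => x i = x j
  | _, _, .memClass i J, x, X => x i ∈ X J
  | _, _, .eqClass I J, _, X => X I = X J
  | _, _, .and φ ψ, x, X => φ.Sat 𝓜 x X ∧ ψ.Sat 𝓜 x X
  | _, _, .not φ, x, X => ¬ φ.Sat 𝓜 x X
  | _, _, .exSet φ, x, X =>
      ∃ a ∈ 𝓜.sets, φ.Sat 𝓜 (Fin.snoc (α := fun _ => ZFSet.{u}) x a) X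
  | _, _, .exClass φ, x, X =>
      ∃ A ∈ 𝓜.classes, φ.Sat 𝓜 x (Fin.snoc (α := fun _ => ZFSet.{u}) X A)

/-- The second-order class comprehension scheme: for every second-order formula `φ(x, A₁, …, Aₘ)`
with class parameters, the class `{x | φ(x, A₁, …, Aₘ)}` exists. -/
def ClassModel.SecondOrderComprehension (𝓜 : ClassModel.{u}) : Prop :=
  ∀ (m : ℕ) (φ : ClassFormula 1 m) (A : Fin m → ZFSet.{u}), (∀ i, A i ∈ 𝓜.classes) →
    ∃ B ∈ 𝓜.classes, ∀ x ∈ 𝓜.sets, (x ∈ B ↔ φ.Sat 𝓜 (fun _ => x) A)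

/-- The model is transitive: elements of sets are sets, and elements of classes are sets. -/
structure ClassModel.IsTransitive (𝓜 : ClassModel.{u}) : Prop where
  sets : ∀ x ∈ 𝓜.sets, ∀ y ∈ x, y ∈ 𝓜.sets
  classes : ∀ X ∈ 𝓜.classes, ∀ y ∈ X, y ∈ 𝓜.sets

open ZFSet (pair)

/-- The axioms of Gödel-Bernays set theory without choice. Ordered pairs are Kuratowski pairs, and
`⟨x, y, z⟩` is `⟨⟨x, y⟩, z⟩` in the axioms on triples. -/
structure ClassModel.SatisfiesGB (𝓜 : ClassModel.{u}) : Prop where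
  extensionality : ∀ x ∈ 𝓜.sets, ∀ y ∈ 𝓜.sets, (∀ z ∈ 𝓜.sets, z ∈ x ↔ z ∈ y) → x = y
  regularity : ∀ x ∈ 𝓜.sets, (∃ y ∈ 𝓜.sets, y ∈ x) →
    ∃ y ∈ 𝓜.sets, y ∈ x ∧ ∀ z ∈ 𝓜.sets, z ∈ y → z ∉ x
  pairing : ∀ x ∈ 𝓜.sets, ∀ y ∈ 𝓜.sets, ∃ z ∈ 𝓜.sets, ∀ w ∈ 𝓜.sets, w ∈ z ↔ w = x ∨ w = y
  union : ∀ x ∈ 𝓜.sets, ∃ z ∈ 𝓜.sets, ∀ w ∈ 𝓜.sets, w ∈ z ↔ ∃ y ∈ 𝓜.sets, y ∈ x ∧ w ∈ y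
  infinity : ∃ x ∈ 𝓜.sets, (∃ e ∈ 𝓜.sets, e ∈ x ∧ ∀ z ∈ 𝓜.sets, z ∉ e) ∧
    ∀ y ∈ 𝓜.sets, y ∈ x → ∃ s ∈ 𝓜.sets, s ∈ x ∧ ∀ z ∈ 𝓜.sets, z ∈ s ↔ z ∈ y ∨ z = y
  powerset : ∀ x ∈ 𝓜.sets, ∃ z ∈ 𝓜.sets, ∀ w ∈ 𝓜.sets,
    w ∈ z ↔ ∀ v ∈ 𝓜.sets, v ∈ w → v ∈ x
  class_extensionality : ∀ A ∈ 𝓜.classes, ∀ B ∈ 𝓜.classes,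
    (∀ x ∈ 𝓜.sets, x ∈ A ↔ x ∈ B) → A = B
  set_is_class : ∀ a ∈ 𝓜.sets, ∃ A ∈ 𝓜.classes, ∀ x ∈ 𝓜.sets, x ∈ a ↔ x ∈ A
  separation : ∀ a ∈ 𝓜.sets, ∀ A ∈ 𝓜.classes, ∃ b ∈ 𝓜.sets, ∀ x ∈ 𝓜.sets,
    x ∈ b ↔ x ∈ a ∧ x ∈ A
  collection : ∀ a ∈ 𝓜.sets, ∀ R ∈ 𝓜.classes,
    (∀ x ∈ 𝓜.sets, x ∈ a → ∃ y ∈ 𝓜.sets, pair x y ∈ R) →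
    ∃ b ∈ 𝓜.sets, ∀ x ∈ 𝓜.sets, x ∈ a → ∃ y ∈ 𝓜.sets, y ∈ b ∧ pair x y ∈ R
  membership : ∃ Y ∈ 𝓜.classes, ∀ x ∈ 𝓜.sets, ∀ y ∈ 𝓜.sets, pair x y ∈ Y ↔ x ∈ y
  intersection : ∀ X ∈ 𝓜.classes, ∀ Y ∈ 𝓜.classes, ∃ Z ∈ 𝓜.classes, ∀ x ∈ 𝓜.sets,
    x ∈ Z ↔ x ∈ X ∧ x ∈ Y
  complement : ∀ X ∈ 𝓜.classes, ∃ Y ∈ 𝓜.classes, ∀ x ∈ 𝓜.sets, x ∈ Y ↔ x ∉ X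
  domain : ∀ X ∈ 𝓜.classes, ∃ Y ∈ 𝓜.classes, ∀ x ∈ 𝓜.sets,
    x ∈ Y ↔ ∃ y ∈ 𝓜.sets, pair x y ∈ X
  product : ∀ X ∈ 𝓜.classes, ∃ Y ∈ 𝓜.classes, ∀ x ∈ 𝓜.sets,
    x ∈ Y ↔ ∃ y ∈ 𝓜.sets, ∃ z ∈ 𝓜.sets, x = pair y z ∧ y ∈ X
  circular_permutation : ∀ X ∈ 𝓜.classes, ∃ Y ∈ 𝓜.classes,
    ∀ x ∈ 𝓜.sets, ∀ y ∈ 𝓜.sets, ∀ z ∈ 𝓜.sets,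
      pair (pair x y) z ∈ Y ↔ pair (pair y z) x ∈ X
  transposition : ∀ X ∈ 𝓜.classes, ∃ Y ∈ 𝓜.classes,
    ∀ x ∈ 𝓜.sets, ∀ y ∈ 𝓜.sets, ∀ z ∈ 𝓜.sets,
      pair (pair x y) z ∈ Y ↔ pair (pair x z) y ∈ X

/-! ## Class symmetric systems -/

/-- The data of a class symmetric system `⟨⟨P, ≤⟩, 𝒢, ℱ⟩`, where `𝒢` is given by its code
`C𝒢 ⊆ V × P²` and `ℱ` by its code `Cℱ ⊆ V × dom C𝒢`. -/
structure SystemData where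
  P : ZFSet.{u}
  le : ZFSet.{u}
  cG : ZFSet.{u}
  cF : ZFSet.{u}

namespace SystemData

variable (S : SystemData.{u})

/-- The conditions, as a type. -/
abbrev Cond : Type (u + 1) := {p : ZFSet.{u} // p ∈ S.P}

/-- The order of the forcing notion. -/
def Le (p q : S.Cond) : Prop := pair p.1 q.1 ∈ S.le

/-- The group of all order automorphisms of the forcing notion, in the ambient universe. -/
abbrev Aut : Type (u + 1) := S.Le ≃r S.Le

/-- `a ∈ dom C𝒢`. -/
def InDomG (a : ZFSet.{u}) : Prop := ∃ z, pair a z ∈ S.cG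

/-- `a ∈ dom Cℱ`. -/
def InDomF (a : ZFSet.{u}) : Prop := ∃ d, pair a d ∈ S.cF

/-- `π = π_a`, that is, `π = {⟨p, q⟩ | ⟨a, p, q⟩ ∈ C𝒢}` with `a ∈ dom C𝒢`. -/
def IsPerm (a : ZFSet.{u}) (π : S.Aut) : Prop :=
  S.InDomG a ∧ ∀ p q : S.Cond, pair a (pair p.1 q.1) ∈ S.cG ↔ π p = q

/-- `{π_a | a ∈ A}`. -/
def perms (A : Set ZFSet.{u}) : Set S.Aut := {π | ∃ a ∈ A, S.IsPerm a π}

/-- `𝒢 = {π_a | a ∈ dom C𝒢}`. -/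
def group : Set S.Aut := S.perms {a | S.InDomG a}

/-- `H_a = {π_d | ⟨a, d⟩ ∈ Cℱ}`. -/
def baseGroup (a : ZFSet.{u}) : Set S.Aut := S.perms {d | pair a d ∈ S.cF}

/-- `H` is (the underlying set of) a group of automorphisms. -/
def IsGroup (H : Set S.Aut) : Prop := ∃ K : Subgroup S.Aut, (K : Set S.Aut) = H

end SystemData

/-- `S` is a class symmetric system in the model `𝓜`. -/
structure IsSymmetricSystem (𝓜 : ClassModel.{u}) (S : SystemData.{u}) : Prop where
  P_class : S.P ∈ 𝓜.classes
  le_class : S.le ∈ 𝓜.classes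
  cG_class : S.cG ∈ 𝓜.classes
  cF_class : S.cF ∈ 𝓜.classes
  le_sub : ∀ z ∈ S.le, ∃ p ∈ S.P, ∃ q ∈ S.P, z = pair p q
  le_refl : ∀ p : S.Cond, S.Le p p
  le_trans : ∀ p q r : S.Cond, S.Le p q → S.Le q r → S.Le p r
  exists_weakest : ∃ o : S.Cond, ∀ p : S.Cond, S.Le p o
  cG_sub : ∀ z ∈ S.cG, ∃ a ∈ 𝓜.sets, ∃ p ∈ S.P, ∃ q ∈ S.P, z = pair a (pair p q)
  perm : ∀ a, S.InDomG a → ∃ π : S.Aut, S.IsPerm a π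
  group : S.IsGroup S.group
  cF_sub : ∀ z ∈ S.cF, ∃ a ∈ 𝓜.sets, ∃ d, S.InDomG d ∧ z = pair a d
  baseGroup : ∀ a, S.InDomF a → S.IsGroup (S.baseGroup a)
  top_mem : ∃ b, S.InDomF b ∧ S.baseGroup b = S.group
  inter_mem : ∀ a b, S.InDomF a → S.InDomF b →
    ∃ c, S.InDomF c ∧ S.baseGroup c ⊆ S.baseGroup a ∩ S.baseGroup b
  normal : ∀ a, S.InDomF a → ∀ π ∈ S.group,
    ∃ c, S.InDomF c ∧ S.baseGroup c ⊆ {τ | ∃ σ ∈ S.baseGroup a, τ = π * σ * π⁻¹}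

/-- `H ∈ ℱ`: `H` is a subgroup of `𝒢` of the form `{π_b | b ∈ C}` with `C` a class of the model
(a subclass of `dom C𝒢`), and it includes some `H_a`. -/
def InFilter (𝓜 : ClassModel.{u}) (S : SystemData.{u}) (H : Set S.Aut) : Prop :=
  S.IsGroup H ∧ (∃ C ∈ 𝓜.classes, (∀ b ∈ C, S.InDomG b) ∧ H = S.perms {b | b ∈ C}) ∧
    ∃ a, S.InDomF a ∧ S.baseGroup a ⊆ H

/-! ## Names -/

theorem rank_lt_of_pair_mem {x y p : ZFSet.{u}} (h : pair y p ∈ x) : y.rank < x.rank := by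
  have h1 : y ∈ ({y} : ZFSet.{u}) := ZFSet.mem_singleton.2 rfl
  have h2 : ({y} : ZFSet.{u}) ∈ pair y p := ZFSet.mem_pair.2 (Or.inl rfl)
  exact (ZFSet.rank_lt_of_mem h1).trans ((ZFSet.rank_lt_of_mem h2).trans (ZFSet.rank_lt_of_mem h))

instance small_pairs (x : ZFSet.{u}) (Q : ZFSet.{u} → Prop) :
    Small.{u} {yp : ZFSet.{u} × ZFSet.{u} // pair yp.1 yp.2 ∈ x ∧ Q yp.2} :=
  small_of_injective (β := {z : ZFSet.{u} // z ∈ x}) (f := fun yp => ⟨pair yp.1.1 yp.1.2, yp.2.1⟩)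
    (by
      rintro ⟨⟨y, p⟩, h⟩ ⟨⟨y', p'⟩, h'⟩ e
      have e' := ZFSet.pair_inj.1 (congrArg Subtype.val e)
      exact Subtype.ext (Prod.ext e'.1 e'.2))

/-- The evaluation `x^G = {y^G | ∃ p ∈ G, ⟨y, p⟩ ∈ x}` of a name. -/
noncomputable def eval (G : Set ZFSet.{u}) (x : ZFSet.{u}) : ZFSet.{u} :=
  ZFSet.range fun yp : {yp : ZFSet.{u} × ZFSet.{u} // pair yp.1 yp.2 ∈ x ∧ yp.2 ∈ G} =>
    eval G yp.1.1
termination_by x.rank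
decreasing_by exact rank_lt_of_pair_mem yp.2.1

theorem mem_eval {G : Set ZFSet.{u}} {x a : ZFSet.{u}} :
    a ∈ eval G x ↔ ∃ y, ∃ p ∈ G, pair y p ∈ x ∧ a = eval G y := by
  rw [eval, ZFSet.mem_range]
  constructor
  · rintro ⟨⟨⟨y, p⟩, h, hp⟩, rfl⟩
    exact ⟨y, p, hp, h, rfl⟩
  · rintro ⟨y, p, hp, h, rfl⟩
    exact ⟨⟨⟨y, p⟩, h, hp⟩, rfl⟩

/-- The action `π(x) = {⟨π(y), π(p)⟩ | ⟨y, p⟩ ∈ x}` of an automorphism on a name. -/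
noncomputable def act {S : SystemData.{u}} (π : S.Aut) (x : ZFSet.{u}) : ZFSet.{u} :=
  ZFSet.range fun yp : {yp : ZFSet.{u} × ZFSet.{u} // pair yp.1 yp.2 ∈ x ∧ yp.2 ∈ S.P} =>
    pair (act π yp.1.1) (π ⟨yp.1.2, yp.2.2⟩).1
termination_by x.rank
decreasing_by exact rank_lt_of_pair_mem yp.2.1

theorem mem_act {S : SystemData.{u}} {π : S.Aut} {x a : ZFSet.{u}} :
    a ∈ act π x ↔ ∃ y, ∃ p : S.Cond, pair y p.1 ∈ x ∧ a = pair (act π y) (π p).1 := by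
  rw [act, ZFSet.mem_range]
  constructor
  · rintro ⟨⟨⟨y, p⟩, h, hp⟩, rfl⟩
    exact ⟨y, ⟨p, hp⟩, h, rfl⟩
  · rintro ⟨y, p, h, rfl⟩
    exact ⟨⟨⟨y, p.1⟩, h, p.2⟩, rfl⟩

/-- `x` is a `P`-name: its elements are pairs `⟨y, p⟩` with, recursively, `y` a `P`-name and
`p ∈ P`. -/
inductive IsName (P : ZFSet.{u}) : ZFSet.{u} → Prop
  | intro (x : ZFSet.{u}) (hx : ∀ z ∈ x, ∃ y, ∃ p ∈ P, z = pair y p)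
      (hy : ∀ y p, pair y p ∈ x → IsName P y) : IsName P x

/-- A name `x` is symmetric: `{π ∈ 𝒢 | π(x) = x} ∈ ℱ`. -/
def IsSymmetricName (𝓜 : ClassModel.{u}) (S : SystemData.{u}) (x : ZFSet.{u}) : Prop :=
  InFilter 𝓜 S {π | π ∈ S.group ∧ act π x = x}

/-- `x` is a hereditarily symmetric name, also called an `𝒮`-name. -/
inductive IsHSName (𝓜 : ClassModel.{u}) (S : SystemData.{u}) : ZFSet.{u} → Prop
  | intro (x : ZFSet.{u}) (name : IsName S.P x) (symm : IsSymmetricName 𝓜 S x)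
      (hered : ∀ y p, pair y p ∈ x → IsHSName 𝓜 S y) : IsHSName 𝓜 S x

/-! ## Generic filters and symmetric extensions -/

/-- `D` is a dense subset of the forcing notion. -/
def IsDense (S : SystemData.{u}) (D : ZFSet.{u}) : Prop :=
  (∀ p ∈ D, p ∈ S.P) ∧ ∀ p : S.Cond, ∃ q : S.Cond, q.1 ∈ D ∧ S.Le q p

/-- `A ⊆ P` is symmetric: `sym(A) = {π ∈ 𝒢 | π[A] = A} ∈ ℱ`. -/
def IsSymmetricSubset (𝓜 : ClassModel.{u}) (S : SystemData.{u}) (A : ZFSet.{u}) : Prop :=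
  (∀ p ∈ A, p ∈ S.P) ∧
    InFilter 𝓜 S {π | π ∈ S.group ∧ π '' {p : S.Cond | p.1 ∈ A} = {p : S.Cond | p.1 ∈ A}}

/-- `G` is a filter on the forcing notion. -/
structure IsFilter (S : SystemData.{u}) (G : Set ZFSet.{u}) : Prop where
  sub : ∀ p ∈ G, p ∈ S.P
  nonempty : G.Nonempty
  upward : ∀ p q : S.Cond, p.1 ∈ G → S.Le p q → q.1 ∈ G
  directed : ∀ p q : S.Cond, p.1 ∈ G → q.1 ∈ G → ∃ r : S.Cond, r.1 ∈ G ∧ S.Le r p ∧ S.Le r q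

/-- `G` is an `𝒮`-generic filter: it is a filter that meets every symmetrically dense class of the
model. -/
structure IsGeneric (𝓜 : ClassModel.{u}) (S : SystemData.{u}) (G : Set ZFSet.{u}) : Prop where
  filter : IsFilter S G
  meets : ∀ D ∈ 𝓜.classes, IsDense S D → IsSymmetricSubset 𝓜 S D → ∃ p ∈ D, p ∈ G

/-- The symmetric extension `𝓜[G]_𝒮`: its sets are the evaluations of the `𝒮`-names in `M`, and its
classes are the evaluations of the `𝒮`-names in `𝒞`. -/
noncomputable def symmetricExtension (𝓜 : ClassModel.{u}) (S : SystemData.{u})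
    (G : Set ZFSet.{u}) : ClassModel.{u} where
  sets := {a | ∃ x ∈ 𝓜.sets, IsHSName 𝓜 S x ∧ a = eval G x}
  classes := {A | ∃ X ∈ 𝓜.classes, IsHSName 𝓜 S X ∧ A = eval G X}

end ClassForcing

/-!
The symmetric extension is analysed by a forcing relation that is defined inside the model.

Since a condition `p` and names `x`, `X` are elements of the model, the statement "`p` forces
`φ(x, X)`" is a predicate on the model, and the whole argument rests on three facts about it: it is
second-order definable (`definable_forces`), it is invariant under the automorphisms in the group
(`forces_act`), and a formula holds in the extension if and only if some condition in the generic
filter forces it (`sat_iff_forces`). Given these, the class `{x | φ(x, X)}` of the extension has the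
name `{⟨x, p⟩ | p ⊩ φ(x, X)}`: this is a class of the model by comprehension in the model, it is
symmetric because every automorphism that fixes the finitely many parameters `X` fixes it
(`exists_comprehension_name`), and its evaluation is correct by the truth lemma.

The relation used is strong forcing: an existential statement is forced by forcing an instance, and
a negation is forced by `p` if no extension of `p` forces the negated formula. Genericity then
enters only through `IsGeneric.decides`: a property of conditions that is definable and invariant
under a group of the filter gives the symmetrically dense class of those conditions that have the
property or have no extension with it. This settles negation, and also equality of names, whose
forcing relation is defined by recursion on the rank.

Definability of the recursively defined notions (the action on names, being a hereditarily symmetric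
name, the forcing of equality) comes from `exists_fixedPoint`: by impredicative comprehension, the
union of all classes `R ⊆ Φ(R)` is a class, and it is a fixed point of the definable monotone
operator `Φ`. As the recursive clauses refer to names of smaller rank, an induction on the rank in
the ambient universe identifies this fixed point with the intended notion. Collection is needed
once, to see that the action maps sets of the model to sets of the model.

Definability is handled semantically. A predicate on a type of environments is `Definable` if some
formula expresses it; closure under connectives, quantifiers and definable terms is stated by
instances, so that instance search proves the definability of a predicate from its shape.
-/

namespace ClassForcing

universe u v w

open ZFSet (pair)

-- Instance search runs through whole formulas, so its default bounds are too small.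
set_option synthInstance.maxSize 100000
set_option synthInstance.maxHeartbeats 400000

/-! ### Formulas and definable predicates -/

namespace ClassFormula

/-- Extension of a renaming of variables to one more bound variable, the last one. -/
def lift {n n' : ℕ} (f : Fin n → Fin n') : Fin (n + 1) → Fin (n' + 1) :=
  Fin.snoc (α := fun _ => Fin (n' + 1)) (fun i => (f i).castSucc) (Fin.last n')

theorem snoc_lift {n n' : ℕ} {α : Type v} (f : Fin n → Fin n') (x : Fin n' → α) (a : α)
    (i : Fin (n + 1)) :
    Fin.snoc (α := fun _ => α) x a (lift f i) =
      Fin.snoc (α := fun _ => α) (fun j => x (f j)) a i := by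
  refine Fin.lastCases ?_ (fun j => ?_) i <;> simp [lift]

/-- Renaming of the free variables of a formula. -/
def rename : {n m n' m' : ℕ} → (Fin n → Fin n') → (Fin m → Fin m') →
    ClassFormula n m → ClassFormula n' m'
  | _, _, _, _, f, _, .mem i j => .mem (f i) (f j)
  | _, _, _, _, f, _, .eq i j => .eq (f i) (f j)
  | _, _, _, _, f, g, .memClass i J => .memClass (f i) (g J)
  | _, _, _, _, _, g, .eqClass I J => .eqClass (g I) (g J)
  | _, _, _, _, f, g, .and φ ψ => .and (φ.rename f g) (ψ.rename f g)
  | _, _, _, _, f, g, .not φ => .not (φ.rename f g)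
  | _, _, _, _, f, g, .exSet φ => .exSet (φ.rename (lift f) g)
  | _, _, _, _, f, g, .exClass φ => .exClass (φ.rename f (lift g))

theorem sat_rename (𝓜 : ClassModel.{u}) {n m : ℕ} (φ : ClassFormula n m) :
    ∀ {n' m' : ℕ} (f : Fin n → Fin n') (g : Fin m → Fin m') (x : Fin n' → ZFSet.{u})
      (X : Fin m' → ZFSet.{u}),
      (φ.rename f g).Sat 𝓜 x X ↔ φ.Sat 𝓜 (fun i => x (f i)) (fun j => X (g j)) := by
  induction φ with
  | mem i j => intros; rfl
  | eq i j => intros; rfl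
  | memClass i j => intros; rfl
  | eqClass i j => intros; rfl
  | and φ ψ h₁ h₂ => intros; simp only [rename, Sat, h₁, h₂]
  | not φ h => intros; simp only [rename, Sat, h]
  | exSet φ h => intros; simp only [rename, Sat, h, snoc_lift]
  | exClass φ h => intros; simp only [rename, Sat, h, snoc_lift]

end ClassFormula

/-- The model is a transitive model of `GB` with second-order class comprehension, that is, of
Kelley-Morse class theory without choice. -/
class KelleyMorse (𝓜 : ClassModel.{u}) : Prop where
  gb : 𝓜.SatisfiesGB
  trans : 𝓜.IsTransitive
  comp : 𝓜.SecondOrderComprehension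

section Basics

variable {𝓜 : ClassModel.{u}} [KelleyMorse 𝓜]

theorem mem_sets_of_mem {x y : ZFSet.{u}} (hx : x ∈ 𝓜.sets) (h : y ∈ x) : y ∈ 𝓜.sets :=
  KelleyMorse.trans.sets x hx y h

theorem mem_sets_of_mem_class {x y : ZFSet.{u}} (hx : x ∈ 𝓜.classes) (h : y ∈ x) : y ∈ 𝓜.sets :=
  KelleyMorse.trans.classes x hx y h

theorem sets_subset_classes {a : ZFSet.{u}} (ha : a ∈ 𝓜.sets) : a ∈ 𝓜.classes := by
  obtain ⟨A, hA, h⟩ := (KelleyMorse.gb (𝓜 := 𝓜)).set_is_class a ha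
  have : a = A := ZFSet.ext fun z =>
    ⟨fun hz => (h z (mem_sets_of_mem ha hz)).1 hz,
      fun hz => (h z (mem_sets_of_mem_class hA hz)).2 hz⟩
  exact this ▸ hA

theorem exists_mem_classes : ∃ A, A ∈ 𝓜.classes := by
  obtain ⟨x, hx, -⟩ := (KelleyMorse.gb (𝓜 := 𝓜)).infinity
  exact ⟨x, sets_subset_classes hx⟩

theorem pairset_mem_sets {a b : ZFSet.{u}} (ha : a ∈ 𝓜.sets) (hb : b ∈ 𝓜.sets) :
    ({a, b} : ZFSet.{u}) ∈ 𝓜.sets := by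
  obtain ⟨z, hz, h⟩ := (KelleyMorse.gb (𝓜 := 𝓜)).pairing a ha b hb
  have : ({a, b} : ZFSet.{u}) = z := by
    ext w
    rw [ZFSet.mem_pair]
    constructor
    · rintro (rfl | rfl)
      · exact (h _ ha).2 (Or.inl rfl)
      · exact (h _ hb).2 (Or.inr rfl)
    · exact fun hw => (h w (mem_sets_of_mem hz hw)).1 hw
  exact this ▸ hz

theorem singleton_mem_sets {a : ZFSet.{u}} (ha : a ∈ 𝓜.sets) :
    ({a} : ZFSet.{u}) ∈ 𝓜.sets := by
  have := pairset_mem_sets ha ha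
  rwa [ZFSet.pair_eq_singleton] at this

theorem pair_mem_sets {a b : ZFSet.{u}} (ha : a ∈ 𝓜.sets) (hb : b ∈ 𝓜.sets) :
    pair a b ∈ 𝓜.sets :=
  pairset_mem_sets (singleton_mem_sets ha) (pairset_mem_sets ha hb)

theorem of_pair_mem_sets {a b : ZFSet.{u}} (h : pair a b ∈ 𝓜.sets) :
    a ∈ 𝓜.sets ∧ b ∈ 𝓜.sets := by
  have h1 : ({a, b} : ZFSet.{u}) ∈ 𝓜.sets :=
    mem_sets_of_mem h (ZFSet.mem_pair.2 (Or.inr rfl))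
  exact ⟨mem_sets_of_mem h1 (ZFSet.mem_pair.2 (Or.inl rfl)),
    mem_sets_of_mem h1 (ZFSet.mem_pair.2 (Or.inr rfl))⟩

end Basics

/-- A context: a type `E` of environments, together with the functions on `E` that may be used as
class variables or class parameters in a formula evaluated at an environment. -/
class Ctx (𝓜 : ClassModel.{u}) (E : Type v) where
  /-- The class variables and the class parameters. -/
  coords : Set (E → ZFSet.{u})
  const : ∀ A ∈ 𝓜.classes, (fun _ => A) ∈ coords
  mem : ∀ f ∈ coords, ∀ e, f e ∈ 𝓜.classes

/-- The type of environments without variables. -/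
abbrev EmptyEnv : Type (u + 1) := Fin 0 → ZFSet.{u}

section Contexts

variable {𝓜 : ClassModel.{u}} [KelleyMorse 𝓜] {E : Type v} {F : Type w}

instance : Ctx 𝓜 EmptyEnv.{u} where
  coords := {f | ∃ A ∈ 𝓜.classes, f = fun _ => A}
  const A hA := ⟨A, hA, rfl⟩
  mem := by rintro _ ⟨A, hA, rfl⟩ _; exact hA

instance [Ctx 𝓜 E] : Ctx 𝓜 (E × 𝓜.classes) where
  coords := {f | f = (fun e => e.2.1) ∨ ∃ g ∈ Ctx.coords 𝓜 (E := E), f = fun e => g e.1}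
  const A hA := Or.inr ⟨_, Ctx.const A hA, rfl⟩
  mem := by
    rintro _ (rfl | ⟨g, hg, rfl⟩) e
    · exact e.2.2
    · exact Ctx.mem g hg _

instance [Ctx 𝓜 E] : Ctx 𝓜 (E × 𝓜.sets) where
  coords := {f | f = (fun e => e.2.1) ∨ ∃ g ∈ Ctx.coords 𝓜 (E := E), f = fun e => g e.1}
  const A hA := Or.inr ⟨_, Ctx.const A hA, rfl⟩
  mem := by
    rintro _ (rfl | ⟨g, hg, rfl⟩) e
    · exact sets_subset_classes e.2.2
    · exact Ctx.mem g hg _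

variable (𝓜)

/-- A predicate on environments is definable if it is given by a second-order formula in the
variables and parameters of the context. Set variables are read as class variables, which is
possible since every set of the model is a class of the model. -/
class Definable [Ctx 𝓜 E] (Q : E → Prop) : Prop where
  out : ∃ (N : ℕ) (φ : ClassFormula 0 N) (f : Fin N → E → ZFSet.{u}),
    (∀ i, f i ∈ Ctx.coords 𝓜) ∧ ∀ e, Q e ↔ φ.Sat 𝓜 Fin.elim0 (fun i => f i e)

/-- A map of environments that forgets some of the variables. -/
class Proj [Ctx 𝓜 E] [Ctx 𝓜 F] (g : E → F) : Prop where
  out : ∀ f ∈ Ctx.coords 𝓜 (E := F), (fun e => f (g e)) ∈ Ctx.coords 𝓜 (E := E)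

instance [Ctx 𝓜 E] : Proj 𝓜 (fun e : E => e) := ⟨fun _ h => h⟩

instance [Ctx 𝓜 E] [Ctx 𝓜 F] (g : E → F × 𝓜.sets) [h : Proj 𝓜 g] :
    Proj 𝓜 (fun e => (g e).1) :=
  ⟨fun f hf => h.out (fun e => f e.1) (Or.inr ⟨f, hf, rfl⟩)⟩

instance [Ctx 𝓜 E] [Ctx 𝓜 F] (g : E → F × 𝓜.classes) [h : Proj 𝓜 g] :
    Proj 𝓜 (fun e => (g e).1) :=
  ⟨fun f hf => h.out (fun e => f e.1) (Or.inr ⟨f, hf, rfl⟩)⟩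

variable {𝓜} [Ctx 𝓜 E] [Ctx 𝓜 F]

omit [KelleyMorse 𝓜] in
theorem Definable.congr {Q : E → Prop} (R : E → Prop) [hR : Definable 𝓜 R]
    (h : ∀ e, Q e ↔ R e) : Definable 𝓜 Q := by
  obtain ⟨N, φ, f, hf, hφ⟩ := hR.out
  exact ⟨N, φ, f, hf, fun e => (h e).trans (hφ e)⟩

omit [KelleyMorse 𝓜] in
theorem Definable.comp {Q : F → Prop} (hQ : Definable 𝓜 Q) {g : E → F} (hg : Proj 𝓜 g) :
    Definable 𝓜 (fun e => Q (g e)) := by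
  obtain ⟨N, φ, f, hf, hφ⟩ := hQ.out
  exact ⟨N, φ, fun i e => f i (g e), fun i => hg.out _ (hf i), fun e => hφ _⟩

instance Definable.not {Q : E → Prop} [hQ : Definable 𝓜 Q] : Definable 𝓜 (fun e => ¬ Q e) := by
  obtain ⟨N, φ, f, hf, hφ⟩ := hQ.out
  exact ⟨N, .not φ, f, hf, fun e => not_congr (hφ e)⟩

instance Definable.and {Q R : E → Prop} [hQ : Definable 𝓜 Q] [hR : Definable 𝓜 R] :
    Definable 𝓜 (fun e => Q e ∧ R e) := by
  obtain ⟨N, φ, f, hf, hφ⟩ := hQ.out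
  obtain ⟨N', φ', f', hf', hφ'⟩ := hR.out
  refine ⟨N + N', .and (φ.rename id (Fin.castAdd N')) (φ'.rename id (Fin.natAdd N)),
    Fin.append f f', fun i => ?_, fun e => ?_⟩
  · refine Fin.addCases (fun j => ?_) (fun j => ?_) i
    · simpa using hf j
    · simpa using hf' j
  · simp only [ClassFormula.Sat, ClassFormula.sat_rename, Fin.append_left, Fin.append_right, hφ,
      hφ', id]

/-- The formula `X ∈ Y` in two class variables: some set with the same elements as `X` is an element
of `Y`. -/
def memFormula : ClassFormula 0 2 :=
  .exSet (.and (.not (.exSet (.not (.and (.not (.and (.mem 1 0) (.not (.memClass 1 0))))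
    (.not (.and (.memClass 1 0) (.not (.mem 1 0)))))))) (.memClass 0 1))

theorem sat_memFormula {x : Fin 0 → ZFSet.{u}} {X : Fin 2 → ZFSet.{u}} (hX : ∀ i, X i ∈ 𝓜.classes) :
    memFormula.Sat 𝓜 x X ↔ X 0 ∈ X 1 := by
  have key : memFormula.Sat 𝓜 x X ↔
      ∃ a ∈ 𝓜.sets, (∀ w ∈ 𝓜.sets, (w ∈ a ↔ w ∈ X 0)) ∧ a ∈ X 1 := by
    simp only [memFormula, ClassFormula.Sat]
    have e0 : ∀ a b : ZFSet.{u}, Fin.snoc (α := fun _ => ZFSet.{u})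
      (Fin.snoc (α := fun _ => ZFSet.{u}) x a) b (0 : Fin 2) = a := fun a b => rfl
    have e1 : ∀ a b : ZFSet.{u}, Fin.snoc (α := fun _ => ZFSet.{u})
      (Fin.snoc (α := fun _ => ZFSet.{u}) x a) b (1 : Fin 2) = b := fun a b => rfl
    have e2 : ∀ a : ZFSet.{u}, Fin.snoc (α := fun _ => ZFSet.{u}) x a (0 : Fin 1) = a :=
      fun a => rfl
    simp only [e0, e1, e2]
    refine exists_congr fun a => and_congr_right fun _ => and_congr_left fun _ => ?_
    grind
  rw [key]
  constructor
  · rintro ⟨a, ha, h, h'⟩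
    have : a = X 0 := ZFSet.ext fun w =>
      ⟨fun hw => (h w (mem_sets_of_mem ha hw)).1 hw,
        fun hw => (h w (mem_sets_of_mem_class (hX 0) hw)).2 hw⟩
    exact this ▸ h'
  · exact fun h => ⟨X 0, mem_sets_of_mem_class (hX 1) h, fun _ _ => Iff.rfl, h⟩

theorem definable_coord_mem {f g : E → ZFSet.{u}} (hf : f ∈ Ctx.coords 𝓜) (hg : g ∈ Ctx.coords 𝓜) :
    Definable 𝓜 (fun e => f e ∈ g e) := by
  refine ⟨2, memFormula, ![f, g], fun i => ?_, fun e => ?_⟩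
  · fin_cases i
    · exact hf
    · exact hg
  · rw [sat_memFormula]
    · rfl
    · intro i
      fin_cases i
      · exact Ctx.mem f hf e
      · exact Ctx.mem g hg e

/-- The coordinates of a context with one more class variable are that variable and the old
coordinates. -/
theorem exists_coords_split {N : ℕ} {f : Fin N → E × 𝓜.classes → ZFSet.{u}}
    (hf : ∀ i, f i ∈ Ctx.coords 𝓜) :
    ∃ (g : Fin N → E → ZFSet.{u}) (j : Fin N → Fin (N + 1)), (∀ i, g i ∈ Ctx.coords 𝓜) ∧
      ∀ e (A : 𝓜.classes), (fun i => f i (e, A)) =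
        fun i => Fin.snoc (α := fun _ => ZFSet.{u}) (fun i => g i e) A.1 (j i) := by
  have h : ∀ i, ∃ g ∈ Ctx.coords 𝓜 (E := E), ∃ j : Fin (N + 1), ∀ e : E × 𝓜.classes,
      f i e = if j = Fin.last N then e.2.1 else g e.1 := by
    intro i
    rcases hf i with h | ⟨g, hg, h⟩
    -- if `f i` is the new variable, any class can serve as the unused old coordinate
    · obtain ⟨A, hA⟩ := exists_mem_classes (𝓜 := 𝓜)
      exact ⟨_, Ctx.const A hA, Fin.last N, fun e => by simp [h]⟩
    · exact ⟨g, hg, i.castSucc, fun e => by simp [h, (Fin.castSucc_lt_last i).ne]⟩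
  choose g hg j hj using h
  refine ⟨g, fun i => if j i = Fin.last N then Fin.last N else i.castSucc, hg, fun e A => ?_⟩
  funext i
  rw [hj]
  by_cases h : j i = Fin.last N <;> simp [h]

instance Definable.exClass {Q : E → ZFSet.{u} → Prop}
    [hQ : Definable 𝓜 (fun e : E × 𝓜.classes => Q e.1 e.2.1)] :
    Definable 𝓜 (fun e => ∃ A ∈ 𝓜.classes, Q e A) := by
  obtain ⟨N, φ, f, hf, hφ⟩ := hQ.out
  obtain ⟨g, j, hg, hj⟩ := exists_coords_split hf
  refine ⟨N, .exClass (φ.rename id j), g, hg, fun e => ?_⟩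
  simp only [ClassFormula.Sat, ClassFormula.sat_rename, id]
  refine exists_congr fun A => and_congr_right fun hA => (hφ (e, ⟨A, hA⟩)).trans (Eq.to_iff ?_)
  rw [hj]

/-- A definable predicate of a set variable is the restriction of one of a class variable. -/
theorem Definable.exists_extend {Q : E → ZFSet.{u} → Prop}
    (hQ : Definable 𝓜 (fun e : E × 𝓜.sets => Q e.1 e.2.1)) :
    ∃ R : E → ZFSet.{u} → Prop, Definable 𝓜 (fun e : E × 𝓜.classes => R e.1 e.2.1) ∧
      ∀ e, ∀ a ∈ 𝓜.sets, (R e a ↔ Q e a) := by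
  obtain ⟨N, φ, f, hf, hφ⟩ := hQ.out
  have h : ∀ i, ∃ g : E → ZFSet.{u} → ZFSet.{u},
      (fun e : E × 𝓜.classes => g e.1 e.2.1) ∈ Ctx.coords 𝓜 ∧ ∀ e, f i e = g e.1 e.2.1 := by
    intro i
    rcases hf i with h | ⟨g, hg, h⟩
    · exact ⟨fun _ A => A, Or.inl rfl, fun e => by rw [h]⟩
    · exact ⟨fun e _ => g e, Or.inr ⟨g, hg, rfl⟩, fun e => by rw [h]⟩
  choose g hg hfg using h
  refine ⟨fun e A => φ.Sat 𝓜 Fin.elim0 fun i => g i e A, ⟨N, φ, _, hg, fun e => Iff.rfl⟩,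
    fun e a ha => ?_⟩
  rw [show Q e a ↔ _ from hφ (e, ⟨a, ha⟩)]
  simp only [hfg]

/-- Second-order comprehension, for definable predicates. -/
theorem Definable.comprehension {Q : E → ZFSet.{u} → Prop}
    (hQ : Definable 𝓜 (fun e : E × 𝓜.sets => Q e.1 e.2.1)) (e : E) :
    ∃ B ∈ 𝓜.classes, ∀ x, x ∈ B ↔ x ∈ 𝓜.sets ∧ Q e x := by
  obtain ⟨R, hR, hRQ⟩ := hQ.exists_extend
  obtain ⟨N, φ, f, hf, hφ⟩ := hR.out
  obtain ⟨g, j, hg, hj⟩ := exists_coords_split hf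
  -- `χ` says that the last class variable has the same elements as the set `x`
  let χ : ClassFormula 1 (N + 1) :=
    .not (.exSet (.not (.and (.not (.and (.mem 1 0) (.not (.memClass 1 (Fin.last N)))))
      (.not (.and (.memClass 1 (Fin.last N)) (.not (.mem 1 0)))))))
  have hχ : ∀ (x : ZFSet.{u}) (X : Fin (N + 1) → ZFSet.{u}), χ.Sat 𝓜 (fun _ => x) X ↔
      ∀ w ∈ 𝓜.sets, (w ∈ x ↔ w ∈ X (Fin.last N)) := by
    intro x X
    simp only [χ, ClassFormula.Sat]
    have e0 : ∀ b : ZFSet.{u}, Fin.snoc (α := fun _ => ZFSet.{u})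
      (fun _ : Fin 1 => x) b (0 : Fin 2) = x := fun b => rfl
    have e1 : ∀ b : ZFSet.{u}, Fin.snoc (α := fun _ => ZFSet.{u})
      (fun _ : Fin 1 => x) b (1 : Fin 2) = b := fun b => rfl
    simp only [e0, e1]
    grind
  obtain ⟨B, hB, h⟩ := (KelleyMorse.comp (𝓜 := 𝓜)) N
    (.exClass (.and χ (φ.rename Fin.elim0 j))) (fun i => g i e) (fun i => Ctx.mem _ (hg i) e)
  have key : ∀ x ∈ 𝓜.sets, (x ∈ B ↔ Q e x) := by
    intro x hx
    rw [h x hx, ← hRQ e x hx, show R e x ↔ _ from hφ (e, ⟨x, sets_subset_classes hx⟩), hj]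
    simp only [ClassFormula.Sat, ClassFormula.sat_rename, hχ, Fin.snoc_last]
    have e0 : ∀ y : Fin 0 → ZFSet.{u}, y = Fin.elim0 := fun y => Subsingleton.elim _ _
    constructor
    · rintro ⟨A, hA, h1, h2⟩
      have : A = x := ZFSet.ext fun w =>
        ⟨fun hw => (h1 w (mem_sets_of_mem_class hA hw)).2 hw,
          fun hw => (h1 w (mem_sets_of_mem hx hw)).1 hw⟩
      subst this
      rwa [e0 (fun _ => _)] at h2
    · intro h2
      refine ⟨x, sets_subset_classes hx, fun _ _ => Iff.rfl, ?_⟩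
      rwa [e0 (fun _ => _)]
  exact ⟨B, hB, fun x => ⟨fun hx => ⟨mem_sets_of_mem_class hB hx,
    (key x (mem_sets_of_mem_class hB hx)).1 hx⟩, fun hx => (key x hx.1).2 hx.2⟩⟩

end Contexts

/-! ### Definable terms and closure properties of definability -/

section Connectives

variable {𝓜 : ClassModel.{u}} [KelleyMorse 𝓜] {E : Type v} {F : Type w} [Ctx 𝓜 E] [Ctx 𝓜 F]

instance Definable.or {Q R : E → Prop} [Definable 𝓜 Q] [Definable 𝓜 R] :
    Definable 𝓜 (fun e => Q e ∨ R e) :=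
  .congr (fun e => ¬ (¬ Q e ∧ ¬ R e)) fun _ => or_iff_not_and_not

instance Definable.imp {Q R : E → Prop} [Definable 𝓜 Q] [Definable 𝓜 R] :
    Definable 𝓜 (fun e => Q e → R e) :=
  .congr (fun e => ¬ Q e ∨ R e) fun _ => imp_iff_not_or

instance Definable.iff {Q R : E → Prop} [Definable 𝓜 Q] [Definable 𝓜 R] :
    Definable 𝓜 (fun e => Q e ↔ R e) :=
  .congr (fun e => (Q e → R e) ∧ (R e → Q e)) fun _ => iff_iff_implies_and_implies

instance Definable.allClass {Q : E → ZFSet.{u} → Prop}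
    [Definable 𝓜 (fun e : E × 𝓜.classes => Q e.1 e.2.1)] :
    Definable 𝓜 (fun e => ∀ A ∈ 𝓜.classes, Q e A) :=
  .congr (fun e => ¬ ∃ A ∈ 𝓜.classes, ¬ Q e A)
    fun e => by simp only [not_exists, not_and, not_not]

variable (𝓜) in
/-- A definable function from environments to classes. -/
class ClassTerm (t : E → ZFSet.{u}) : Prop where
  mem : ∀ e, t e ∈ 𝓜.classes
  graph : Definable 𝓜 (fun e : E × 𝓜.classes => e.2.1 = t e.1)

variable (𝓜) in
/-- A definable function from environments to sets. -/
class SetTerm (t : E → ZFSet.{u}) : Prop extends ClassTerm 𝓜 t where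
  mem_sets : ∀ e, t e ∈ 𝓜.sets

variable (𝓜) in
/-- `A` is a class of the model. -/
class IsClass (A : ZFSet.{u}) : Prop where
  out : A ∈ 𝓜.classes

omit [KelleyMorse 𝓜] in
theorem Proj.prodClass {F' : Type*} [Ctx 𝓜 F'] {g : E → F} {h : E → F' × 𝓜.classes}
    (hg : Proj 𝓜 g) (hh : Proj 𝓜 h) : Proj 𝓜 (fun e => (g e, (h e).2)) := by
  refine ⟨?_⟩
  rintro _ (rfl | ⟨f, hf, rfl⟩)
  · exact hh.out (fun e => e.2.1) (Or.inl rfl)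
  · exact hg.out _ hf

theorem Proj.prodSet {F' : Type*} [Ctx 𝓜 F'] {g : E → F} {h : E → F' × 𝓜.sets}
    (hg : Proj 𝓜 g) (hh : Proj 𝓜 h) : Proj 𝓜 (fun e => (g e, (h e).2)) := by
  refine ⟨?_⟩
  rintro _ (rfl | ⟨f, hf, rfl⟩)
  · exact hh.out (fun e => e.2.1) (Or.inl rfl)
  · exact hg.out _ hf

theorem Proj.fstSet : Proj 𝓜 (fun e : E × 𝓜.sets => e.1) := inferInstance

omit [KelleyMorse 𝓜] in
theorem Proj.fstClass : Proj 𝓜 (fun e : E × 𝓜.classes => e.1) := inferInstance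

theorem Proj.mapSet {g : E → F} (hg : Proj 𝓜 g) :
    Proj 𝓜 (fun e : E × 𝓜.sets => (g e.1, e.2)) :=
  .prodSet (h := fun e : E × 𝓜.sets => e) ⟨fun f hf => Or.inr ⟨_, hg.out f hf, rfl⟩⟩ inferInstance

omit [KelleyMorse 𝓜] in
theorem Proj.mapClass {g : E → F} (hg : Proj 𝓜 g) :
    Proj 𝓜 (fun e : E × 𝓜.classes => (g e.1, e.2)) :=
  .prodClass (h := fun e : E × 𝓜.classes => e) ⟨fun f hf => Or.inr ⟨_, hg.out f hf, rfl⟩⟩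
    inferInstance

theorem classes_ext {A B : ZFSet.{u}} (hA : A ∈ 𝓜.classes) (hB : B ∈ 𝓜.classes)
    (h : ∀ x ∈ 𝓜.sets, (x ∈ A ↔ x ∈ B)) : A = B :=
  ZFSet.ext fun x => ⟨fun hx => (h x (mem_sets_of_mem_class hA hx)).1 hx,
    fun hx => (h x (mem_sets_of_mem_class hB hx)).2 hx⟩

theorem definable_coord_eq {f g : E → ZFSet.{u}} (hf : f ∈ Ctx.coords 𝓜) (hg : g ∈ Ctx.coords 𝓜) :
    Definable 𝓜 (fun e => f e = g e) := by
  have h1 : Definable 𝓜 (fun e : E × 𝓜.classes => e.2.1 ∈ f e.1) :=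
    definable_coord_mem (Or.inl rfl) (Or.inr ⟨f, hf, rfl⟩)
  have h2 : Definable 𝓜 (fun e : E × 𝓜.classes => e.2.1 ∈ g e.1) :=
    definable_coord_mem (Or.inl rfl) (Or.inr ⟨g, hg, rfl⟩)
  refine .congr (fun e => ∀ A ∈ 𝓜.classes, (A ∈ f e ↔ A ∈ g e)) fun e => ?_
  exact ⟨fun h A _ => by rw [h], fun h => classes_ext (Ctx.mem f hf e) (Ctx.mem g hg e)
    fun x hx => h x (sets_subset_classes hx)⟩

theorem classTerm_coord {f : E → ZFSet.{u}} (hf : f ∈ Ctx.coords 𝓜) : ClassTerm 𝓜 f :=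
  ⟨Ctx.mem f hf, definable_coord_eq (Or.inl rfl) (Or.inr ⟨f, hf, rfl⟩)⟩

instance ClassTerm.var (g : E → F × 𝓜.classes) [h : Proj 𝓜 g] :
    ClassTerm 𝓜 (fun e => (g e).2.1) :=
  classTerm_coord (h.out (fun e => e.2.1) (Or.inl rfl))

instance SetTerm.var (g : E → F × 𝓜.sets) [h : Proj 𝓜 g] :
    SetTerm 𝓜 (fun e => (g e).2.1) where
  toClassTerm := classTerm_coord (h.out (fun e => e.2.1) (Or.inl rfl))
  mem_sets e := (g e).2.2

/-- Substitution of a definable class for a class variable. -/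
theorem Definable.substClass {Q : E → ZFSet.{u} → Prop} (t : E → ZFSet.{u}) [ht : ClassTerm 𝓜 t]
    (hQ : Definable 𝓜 (fun e : E × 𝓜.classes => Q e.1 e.2.1)) :
    Definable 𝓜 (fun e => Q e (t e)) := by
  have := ht.graph
  exact .congr (fun e => ∃ A ∈ 𝓜.classes, A = t e ∧ Q e A)
    fun e => ⟨fun h => ⟨_, ht.mem e, rfl, h⟩, fun ⟨A, _, h, h'⟩ => h ▸ h'⟩

omit [KelleyMorse 𝓜] in
theorem ClassTerm.comp {t : F → ZFSet.{u}} (ht : ClassTerm 𝓜 t) {g : E → F} (hg : Proj 𝓜 g) :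
    ClassTerm 𝓜 (fun e => t (g e)) where
  mem _ := ht.mem _
  graph := ht.graph.comp hg.mapClass

instance Definable.mem {t s : E → ZFSet.{u}} [ht : ClassTerm 𝓜 t] [hs : ClassTerm 𝓜 s] :
    Definable 𝓜 (fun e => t e ∈ s e) := by
  have := hs.comp (.fstClass (E := E))
  refine Definable.substClass t (Q := fun e A => A ∈ s e)
    (Definable.substClass (fun e => s e.1) (Q := fun (e : E × 𝓜.classes) A => e.2.1 ∈ A) ?_)
  exact definable_coord_mem (Or.inr ⟨_, Or.inl rfl, rfl⟩) (Or.inl rfl)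

instance Definable.eq {t s : E → ZFSet.{u}} [ht : ClassTerm 𝓜 t] [hs : ClassTerm 𝓜 s] :
    Definable 𝓜 (fun e => t e = s e) := by
  have := hs.comp (.fstClass (E := E))
  refine Definable.substClass t (Q := fun e A => A = s e)
    (Definable.substClass (fun e => s e.1) (Q := fun (e : E × 𝓜.classes) A => e.2.1 = A) ?_)
  exact definable_coord_eq (Or.inr ⟨_, Or.inl rfl, rfl⟩) (Or.inl rfl)

instance Definable.memSets {t : E → ZFSet.{u}} [ht : ClassTerm 𝓜 t] :
    Definable 𝓜 (fun e => t e ∈ 𝓜.sets) := by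
  have := ht.comp (.fstClass (E := E))
  refine .congr (fun e => ∃ A ∈ 𝓜.classes, t e ∈ A) fun e => ?_
  exact ⟨fun h => ⟨{t e}, sets_subset_classes (singleton_mem_sets h), ZFSet.mem_singleton.2 rfl⟩,
    fun ⟨A, hA, h⟩ => mem_sets_of_mem_class hA h⟩

instance Definable.exSet {Q : E → ZFSet.{u} → Prop}
    [hQ : Definable 𝓜 (fun e : E × 𝓜.sets => Q e.1 e.2.1)] :
    Definable 𝓜 (fun e => ∃ a ∈ 𝓜.sets, Q e a) := by
  obtain ⟨R, hR, hRQ⟩ := hQ.exists_extend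
  refine .congr (fun e => ∃ A ∈ 𝓜.classes, A ∈ 𝓜.sets ∧ R e A) fun e => ?_
  exact ⟨fun ⟨a, ha, h⟩ => ⟨a, sets_subset_classes ha, ha, (hRQ e a ha).2 h⟩,
    fun ⟨a, _, ha, h⟩ => ⟨a, ha, (hRQ e a ha).1 h⟩⟩

instance Definable.allSet {Q : E → ZFSet.{u} → Prop}
    [Definable 𝓜 (fun e : E × 𝓜.sets => Q e.1 e.2.1)] :
    Definable 𝓜 (fun e => ∀ a ∈ 𝓜.sets, Q e a) :=
  .congr (fun e => ¬ ∃ A ∈ 𝓜.sets, ¬ Q e A)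
    fun e => by simp only [not_exists, not_and, not_not]

instance Definable.exMem {t : E → ZFSet.{u}} {Q : E → ZFSet.{u} → Prop} [ht : ClassTerm 𝓜 t]
    [Definable 𝓜 (fun e : E × 𝓜.sets => Q e.1 e.2.1)] :
    Definable 𝓜 (fun e => ∃ a ∈ t e, Q e a) := by
  have := ht.comp (.fstSet (E := E))
  refine .congr (fun e => ∃ a ∈ 𝓜.sets, a ∈ t e ∧ Q e a) fun e => ?_
  exact ⟨fun ⟨a, ha, h⟩ => ⟨a, mem_sets_of_mem_class (ht.mem e) ha, ha, h⟩,
    fun ⟨a, _, h⟩ => ⟨a, h⟩⟩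

instance Definable.allMem {t : E → ZFSet.{u}} {Q : E → ZFSet.{u} → Prop} [ht : ClassTerm 𝓜 t]
    [Definable 𝓜 (fun e : E × 𝓜.sets => Q e.1 e.2.1)] :
    Definable 𝓜 (fun e => ∀ a ∈ t e, Q e a) :=
  .congr (fun e => ¬ ∃ a ∈ t e, ¬ Q e a)
    fun e => by simp only [not_exists, not_and, not_not]

/-- A function from environments is a definable class if membership in its values is definable. -/
theorem ClassTerm.of_mem {t : E → ZFSet.{u}} (h : ∀ e, ∀ z ∈ t e, z ∈ 𝓜.sets)
    (ht : Definable 𝓜 (fun e : E × 𝓜.sets => e.2.1 ∈ t e.1)) : ClassTerm 𝓜 t := by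
  have hm : ∀ e, t e ∈ 𝓜.classes := by
    intro e
    obtain ⟨B, hB, h'⟩ := Definable.comprehension (Q := fun e x => x ∈ t e) ht e
    have : t e = B := ZFSet.ext fun x => by rw [h']; exact ⟨fun hx => ⟨h e x hx, hx⟩, And.right⟩
    exact this ▸ hB
  refine ⟨hm, ?_⟩
  have := ht.comp (Proj.fstClass.mapSet (E := E × 𝓜.classes))
  refine .congr (fun e : E × 𝓜.classes => ∀ a ∈ 𝓜.sets, (a ∈ e.2.1 ↔ a ∈ t e.1)) fun e => ?_
  exact ⟨fun h a _ => by rw [h], classes_ext e.2.2 (hm _)⟩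

theorem SetTerm.of_mem {t : E → ZFSet.{u}} (h : ∀ e, t e ∈ 𝓜.sets)
    (ht : Definable 𝓜 (fun e : E × 𝓜.sets => e.2.1 ∈ t e.1)) : SetTerm 𝓜 t where
  toClassTerm := ClassTerm.of_mem (fun e _ hz => mem_sets_of_mem (h e) hz) ht
  mem_sets := h

theorem SetTerm.of_graph {t : E → ZFSet.{u}} (h : ∀ e, t e ∈ 𝓜.sets)
    (ht : Definable 𝓜 (fun e : E × 𝓜.sets => e.2.1 = t e.1)) : SetTerm 𝓜 t where
  mem e := sets_subset_classes (h e)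
  graph := by
    have := ht.comp (Proj.fstClass.mapSet (E := E × 𝓜.classes))
    exact .congr (fun e : E × 𝓜.classes => ∃ a ∈ 𝓜.sets, a = t e.1 ∧ e.2.1 = a)
      fun e => ⟨fun he => ⟨_, h e.1, rfl, he⟩, fun ⟨_, _, h, h'⟩ => h'.trans h⟩
  mem_sets := h

omit [KelleyMorse 𝓜] in
theorem SetTerm.comp {t : F → ZFSet.{u}} (ht : SetTerm 𝓜 t) {g : E → F} (hg : Proj 𝓜 g) :
    SetTerm 𝓜 (fun e => t (g e)) where
  toClassTerm := ht.toClassTerm.comp hg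
  mem_sets _ := ht.mem_sets _

instance SetTerm.pairset {t s : E → ZFSet.{u}} [ht : SetTerm 𝓜 t] [hs : SetTerm 𝓜 s] :
    SetTerm 𝓜 (fun e => ({t e, s e} : ZFSet.{u})) := by
  have := ht.comp (.fstSet (E := E))
  have := hs.comp (.fstSet (E := E))
  exact .of_mem (fun e => pairset_mem_sets (ht.mem_sets e) (hs.mem_sets e))
    (.congr (fun e : E × 𝓜.sets => e.2.1 = t e.1 ∨ e.2.1 = s e.1) fun _ => ZFSet.mem_pair)

instance SetTerm.pair {t s : E → ZFSet.{u}} [ht : SetTerm 𝓜 t] [hs : SetTerm 𝓜 s] :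
    SetTerm 𝓜 (fun e => pair (t e) (s e)) := by
  have h1 : SetTerm 𝓜 (fun e => ({t e} : ZFSet.{u})) := by
    simpa only [ZFSet.pair_eq_singleton] using SetTerm.pairset (𝓜 := 𝓜) (t := t) (s := t)
  exact SetTerm.pairset (𝓜 := 𝓜) (t := fun e => ({t e} : ZFSet.{u})) (s := fun e => {t e, s e})

instance Definable.exPairMem {t : E → ZFSet.{u}} {Q : E → ZFSet.{u} → ZFSet.{u} → Prop}
    [ht : ClassTerm 𝓜 t] [Definable 𝓜 (fun e : (E × 𝓜.sets) × 𝓜.sets => Q e.1.1 e.1.2.1 e.2.1)] :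
    Definable 𝓜 (fun e => ∃ a b, pair a b ∈ t e ∧ Q e a b) := by
  have := (ht.comp .fstSet).comp (.fstSet (E := E × 𝓜.sets))
  refine .congr (fun e => ∃ a ∈ 𝓜.sets, ∃ b ∈ 𝓜.sets, pair a b ∈ t e ∧ Q e a b) fun e => ?_
  constructor
  · rintro ⟨a, b, hab, h⟩
    obtain ⟨ha, hb⟩ := of_pair_mem_sets (mem_sets_of_mem_class (ht.mem e) hab)
    exact ⟨a, ha, b, hb, hab, h⟩
  · rintro ⟨a, -, b, -, h⟩
    exact ⟨a, b, h⟩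

instance Definable.allPairMem {t : E → ZFSet.{u}} {Q : E → ZFSet.{u} → ZFSet.{u} → Prop}
    [ht : ClassTerm 𝓜 t] [Definable 𝓜 (fun e : (E × 𝓜.sets) × 𝓜.sets => Q e.1.1 e.1.2.1 e.2.1)] :
    Definable 𝓜 (fun e => ∀ a b, pair a b ∈ t e → Q e a b) :=
  .congr (fun e => ¬ ∃ a b, pair a b ∈ t e ∧ ¬ Q e a b)
    fun e => by simp only [not_exists, not_and, not_not]

instance ClassTerm.const (A : ZFSet.{u}) [hA : IsClass 𝓜 A] : ClassTerm 𝓜 (fun _ : E => A) :=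
  classTerm_coord (Ctx.const A hA.out)

variable (𝓜) in
/-- `a` is a set of the model. -/
class IsSet (a : ZFSet.{u}) : Prop where
  out : a ∈ 𝓜.sets

instance SetTerm.const (a : ZFSet.{u}) [ha : IsSet 𝓜 a] : SetTerm 𝓜 (fun _ : E => a) where
  toClassTerm := classTerm_coord (Ctx.const a (sets_subset_classes ha.out))
  mem_sets _ := ha.out

end Connectives

/-! ### Fixed points and images -/

section FixedPoint

variable {𝓜 : ClassModel.{u}} [KelleyMorse 𝓜]

/-- Second-order comprehension yields fixed points of definable monotone operators: the union of
all classes `X` with `X ⊆ Φ(X)` is one. -/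
theorem exists_fixedPoint (Φ : ZFSet.{u} → ZFSet.{u} → Prop)
    [hΦ : Definable 𝓜 (fun e : (EmptyEnv × 𝓜.classes) × 𝓜.sets => Φ e.1.2.1 e.2.1)]
    (mono : ∀ R ∈ 𝓜.classes, ∀ R' ∈ 𝓜.classes, R ⊆ R' → ∀ z, Φ R z → Φ R' z) :
    ∃ R ∈ 𝓜.classes, ∀ z ∈ 𝓜.sets, (z ∈ R ↔ Φ R z) := by
  have h1 : Definable 𝓜 (fun e : ((EmptyEnv × 𝓜.sets) × 𝓜.classes) × 𝓜.sets => Φ e.1.2.1 e.2.1) :=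
    hΦ.comp (Proj.fstSet.mapClass.mapSet (E := (EmptyEnv × 𝓜.sets) × 𝓜.classes))
  obtain ⟨U, hU, hUz⟩ := Definable.comprehension (𝓜 := 𝓜)
    (Q := fun (_ : EmptyEnv) z => ∃ X ∈ 𝓜.classes, z ∈ X ∧ ∀ w ∈ X, Φ X w) inferInstance Fin.elim0
  obtain ⟨W, hW, hWz⟩ := Definable.comprehension (𝓜 := 𝓜)
    (Q := fun (e : EmptyEnv × 𝓜.classes) z => Φ e.2.1 z) inferInstance (Fin.elim0, ⟨U, hU⟩)
  have hUW : ∀ z ∈ U, Φ U z := by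
    intro z hz
    obtain ⟨-, X, hX, hzX, h⟩ := (hUz z).1 hz
    refine mono X hX U hU (fun w hw => ?_) z (h z hzX)
    exact (hUz w).2 ⟨mem_sets_of_mem_class hX hw, X, hX, hw, h⟩
  have hsub : U ⊆ W := fun z hz => (hWz z).2 ⟨mem_sets_of_mem_class hU hz, hUW z hz⟩
  refine ⟨U, hU, fun z hz => ⟨hUW z, fun h => ?_⟩⟩
  exact (hUz z).2 ⟨hz, W, hW, (hWz z).2 ⟨hz, h⟩,
    fun w hw => mono U hU W hW hsub w ((hWz w).1 hw).2⟩

/-- The image of a set under a definable partial function is a set. -/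
theorem exists_image (Q : ZFSet.{u} → ZFSet.{u} → Prop)
    [hQ : Definable 𝓜 (fun e : (EmptyEnv × 𝓜.sets) × 𝓜.sets => Q e.1.2.1 e.2.1)]
    {a : ZFSet.{u}} (ha : a ∈ 𝓜.sets)
    (h : ∀ z ∈ a, ∀ w ∈ 𝓜.sets, ∀ w' ∈ 𝓜.sets, Q z w → Q z w' → w = w') :
    ∃ b ∈ 𝓜.sets, ∀ w, w ∈ b ↔ w ∈ 𝓜.sets ∧ ∃ z ∈ a, Q z w := by
  have : IsSet 𝓜 a := ⟨ha⟩
  have h1 : Definable 𝓜 (fun e : ((EmptyEnv × 𝓜.sets) × 𝓜.sets) × 𝓜.sets => Q e.1.2.1 e.2.1) :=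
    hQ.comp (Proj.fstSet.mapSet.mapSet (E := (EmptyEnv × 𝓜.sets) × 𝓜.sets))
  have h2 : Definable 𝓜 (fun e : (EmptyEnv × 𝓜.sets) × 𝓜.sets => Q e.2.1 e.1.2.1) :=
    hQ.comp (.prodSet (.prodSet (g := fun e : (EmptyEnv × 𝓜.sets) × 𝓜.sets => e.1.1)
      (h := fun e => e) inferInstance inferInstance) (h := fun e => e.1) inferInstance)
  obtain ⟨R, hR, hRz⟩ := Definable.comprehension (𝓜 := 𝓜)
    (Q := fun (_ : EmptyEnv) p => ∃ z ∈ 𝓜.sets, ∃ w ∈ 𝓜.sets, p = pair z w ∧ Q z w)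
    inferInstance Fin.elim0
  obtain ⟨I, hI, hIz⟩ := Definable.comprehension (𝓜 := 𝓜)
    (Q := fun (_ : EmptyEnv) w => ∃ z ∈ a, Q z w) inferInstance Fin.elim0
  obtain ⟨D, hD, hDz⟩ := Definable.comprehension (𝓜 := 𝓜)
    (Q := fun (_ : EmptyEnv) z => ∃ w ∈ 𝓜.sets, Q z w) inferInstance Fin.elim0
  have hRp : ∀ z ∈ 𝓜.sets, ∀ w ∈ 𝓜.sets, (pair z w ∈ R ↔ Q z w) := by
    intro z hz w hw
    rw [hRz]
    constructor
    · rintro ⟨-, z', -, w', -, e, hQ⟩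
      obtain ⟨rfl, rfl⟩ := ZFSet.pair_inj.1 e
      exact hQ
    · exact fun hQ => ⟨pair_mem_sets hz hw, z, hz, w, hw, rfl, hQ⟩
  obtain ⟨a', ha', haz⟩ := (KelleyMorse.gb (𝓜 := 𝓜)).separation a ha D hD
  obtain ⟨b, hb, hab⟩ := (KelleyMorse.gb (𝓜 := 𝓜)).collection a' ha' R hR fun z hz hza => by
    obtain ⟨-, w, hw, hQ⟩ := (hDz z).1 ((haz z hz).1 hza).2
    exact ⟨w, hw, (hRp z hz w hw).2 hQ⟩
  obtain ⟨c, hc, hbc⟩ := (KelleyMorse.gb (𝓜 := 𝓜)).separation b hb I hI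
  refine ⟨c, hc, fun w => ⟨fun hw => ?_, ?_⟩⟩
  · exact (hIz w).1 ((hbc w (mem_sets_of_mem hc hw)).1 hw).2
  · rintro ⟨hw, z, hz, hQ⟩
    have hz' := mem_sets_of_mem ha hz
    obtain ⟨y, hy, hyb, hzy⟩ := hab z hz' ((haz z hz').2 ⟨hz, (hDz z).2 ⟨hz', w, hw, hQ⟩⟩)
    obtain rfl := h z hz w hw y hy hQ ((hRp z hz' y hy).1 hzy)
    exact (hbc _ hy).2 ⟨hyb, (hIz _).2 ⟨hw, z, hz, hQ⟩⟩

end FixedPoint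

/-! ### Automorphisms and their action on names -/

section Automorphisms

namespace SystemData

variable (S : SystemData.{u})

open Classical in
/-- The automorphism `π_d` with code `d`; the identity if `d` is not a code. -/
noncomputable def permOf (d : ZFSet.{u}) : S.Aut :=
  if h : ∃ π, S.IsPerm d π then h.choose else 1

open Classical in
/-- The value `π_d(p)`, extended by the identity outside of the forcing notion. -/
noncomputable def app (d p : ZFSet.{u}) : ZFSet.{u} :=
  if h : p ∈ S.P then (S.permOf d ⟨p, h⟩).1 else p

variable {S}

theorem app_of_mem (d : ZFSet.{u}) (p : S.Cond) : S.app d p.1 = (S.permOf d p).1 := dif_pos p.2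

theorem permOf_of_not {d : ZFSet.{u}} (hd : ¬ S.InDomG d) : S.permOf d = 1 :=
  dif_neg fun ⟨_, h⟩ => hd h.1

theorem IsPerm.unique {d : ZFSet.{u}} {π σ : S.Aut} (hπ : S.IsPerm d π) (hσ : S.IsPerm d σ) :
    π = σ :=
  RelIso.ext fun p => (((hσ.2 p (π p)).1 ((hπ.2 p (π p)).2 rfl))).symm

theorem baseGroup_subset_group (a : ZFSet.{u}) : S.baseGroup a ⊆ S.group :=
  fun _ ⟨d, _, h⟩ => ⟨d, h.1, h⟩

end SystemData

variable (𝓜 : ClassModel.{u}) {S : SystemData.{u}} [hS : Fact (IsSymmetricSystem 𝓜 S)]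

include hS

theorem isPerm_permOf {d : ZFSet.{u}} (hd : S.InDomG d) : S.IsPerm d (S.permOf d) := by
  have h := hS.out.perm d hd
  rw [SystemData.permOf, dif_pos h]
  exact h.choose_spec

theorem mem_group {π : S.Aut} : π ∈ S.group ↔ ∃ d, S.InDomG d ∧ π = S.permOf d := by
  constructor
  · rintro ⟨d, hd, h⟩
    exact ⟨d, hd, h.unique (isPerm_permOf 𝓜 hd)⟩
  · rintro ⟨d, hd, rfl⟩
    exact ⟨d, hd, isPerm_permOf 𝓜 hd⟩

theorem inDomG_of_pair_mem_cF {a d : ZFSet.{u}} (h : pair a d ∈ S.cF) : S.InDomG d := by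
  obtain ⟨a', -, d', hd', e⟩ := hS.out.cF_sub _ h
  obtain ⟨rfl, rfl⟩ := ZFSet.pair_inj.1 e
  exact hd'

theorem mem_baseGroup {a : ZFSet.{u}} {π : S.Aut} :
    π ∈ S.baseGroup a ↔ ∃ d, pair a d ∈ S.cF ∧ π = S.permOf d := by
  constructor
  · rintro ⟨d, hd, h⟩
    exact ⟨d, hd, h.unique (isPerm_permOf 𝓜 h.1)⟩
  · rintro ⟨d, hd, rfl⟩
    exact ⟨d, hd, isPerm_permOf 𝓜 (inDomG_of_pair_mem_cF 𝓜 hd)⟩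

theorem one_mem_group : (1 : S.Aut) ∈ S.group := by
  obtain ⟨K, hK⟩ := hS.out.group
  exact hK ▸ K.one_mem

theorem mul_mem_group {π σ : S.Aut} (hπ : π ∈ S.group) (hσ : σ ∈ S.group) : π * σ ∈ S.group := by
  obtain ⟨K, hK⟩ := hS.out.group
  rw [← hK] at hπ hσ ⊢
  exact K.mul_mem hπ hσ

theorem inv_mem_group {π : S.Aut} (hπ : π ∈ S.group) : π⁻¹ ∈ S.group := by
  obtain ⟨K, hK⟩ := hS.out.group
  rw [← hK] at hπ ⊢
  exact K.inv_mem hπ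

end Automorphisms

section Action

variable {S : SystemData.{u}}

theorem act_mul (π σ : S.Aut) (x : ZFSet.{u}) : act (π * σ) x = act π (act σ x) := by
  ext z
  simp only [mem_act]
  constructor
  · rintro ⟨y, p, h, rfl⟩
    exact ⟨act σ y, σ p, ⟨y, p, h, rfl⟩, by rw [← act_mul π σ y]; rfl⟩
  · rintro ⟨w, q, ⟨y, p, h, e⟩, rfl⟩
    obtain ⟨rfl, e'⟩ := ZFSet.pair_inj.1 e
    obtain rfl := Subtype.ext e'
    exact ⟨y, p, h, by rw [act_mul π σ y]; rfl⟩
termination_by x.rank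
decreasing_by all_goals exact rank_lt_of_pair_mem h

theorem IsName.exists_eq_pair {x z : ZFSet.{u}} (h : IsName S.P x) (hz : z ∈ x) :
    ∃ (y : ZFSet.{u}) (p : S.Cond), z = pair y p.1 ∧ IsName S.P y := by
  cases h with
  | intro _ hx hy =>
    obtain ⟨y, p, hp, rfl⟩ := hx z hz
    exact ⟨y, ⟨p, hp⟩, rfl, hy y p hz⟩

theorem IsName.of_pair_mem {x y p : ZFSet.{u}} (h : IsName S.P x) (hz : pair y p ∈ x) :
    IsName S.P y ∧ p ∈ S.P := by
  obtain ⟨y', p', e, h⟩ := h.exists_eq_pair hz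
  obtain ⟨rfl, rfl⟩ := ZFSet.pair_inj.1 e
  exact ⟨h, p'.2⟩

theorem act_one {x : ZFSet.{u}} (hx : IsName S.P x) : act (1 : S.Aut) x = x := by
  induction hx with
  | intro x hx hy ih =>
    ext z
    rw [mem_act]
    constructor
    · rintro ⟨y, p, h, rfl⟩
      rw [ih y p h]
      exact h
    · intro hz
      obtain ⟨y, p, hp, rfl⟩ := hx z hz
      exact ⟨y, ⟨p, hp⟩, hz, by rw [ih y p hz]; rfl⟩

theorem act_inv_act {x : ZFSet.{u}} (hx : IsName S.P x) (π : S.Aut) : act π⁻¹ (act π x) = x := by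
  rw [← act_mul, inv_mul_cancel, act_one hx]

theorem pair_mem_act {x y : ZFSet.{u}} {p : S.Cond} (π : S.Aut) (h : pair y p.1 ∈ x) :
    pair (act π y) (π p).1 ∈ act π x :=
  mem_act.2 ⟨y, p, h, rfl⟩

end Action

section Definability

variable {𝓜 : ClassModel.{u}} [KelleyMorse 𝓜] {S : SystemData.{u}}
  [hS : Fact (IsSymmetricSystem 𝓜 S)]

instance : IsClass 𝓜 S.P := ⟨hS.out.P_class⟩
instance : IsClass 𝓜 S.le := ⟨hS.out.le_class⟩
instance : IsClass 𝓜 S.cG := ⟨hS.out.cG_class⟩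
instance : IsClass 𝓜 S.cF := ⟨hS.out.cF_class⟩

variable {E : Type v} [Ctx 𝓜 E]

instance Definable.exPairMemLeft {t s : E → ZFSet.{u}} [ht : SetTerm 𝓜 t] [hs : ClassTerm 𝓜 s] :
    Definable 𝓜 (fun e => ∃ z, pair (t e) z ∈ s e) := by
  have := ht.comp (.fstSet (E := E))
  have := hs.comp (.fstSet (E := E))
  exact .congr (fun e => ∃ z ∈ 𝓜.sets, pair (t e) z ∈ s e) fun e =>
    ⟨fun ⟨z, h⟩ => ⟨z, (of_pair_mem_sets (mem_sets_of_mem_class (hs.mem e) h)).2, h⟩,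
      fun ⟨z, _, h⟩ => ⟨z, h⟩⟩

instance Definable.allPairMemLeft {t s : E → ZFSet.{u}} {Q : E → ZFSet.{u} → Prop}
    [ht : SetTerm 𝓜 t] [hs : ClassTerm 𝓜 s]
    [Definable 𝓜 (fun e : E × 𝓜.sets => Q e.1 e.2.1)] :
    Definable 𝓜 (fun e => ∀ z, pair (t e) z ∈ s e → Q e z) := by
  have := ht.comp (.fstSet (E := E))
  have := hs.comp (.fstSet (E := E))
  exact .congr (fun e => ∀ z ∈ 𝓜.sets, pair (t e) z ∈ s e → Q e z) fun e =>
    ⟨fun h z _ => h z,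
      fun h z hz => h z (of_pair_mem_sets (mem_sets_of_mem_class (hs.mem e) hz)).2 hz⟩

instance Definable.inDomG {d : E → ZFSet.{u}} [hd : SetTerm 𝓜 d] :
    Definable 𝓜 (fun e => S.InDomG (d e)) :=
  .congr (fun e => ∃ z, pair (d e) z ∈ S.cG) fun _ => Iff.rfl

instance Definable.inDomF {d : E → ZFSet.{u}} [hd : SetTerm 𝓜 d] :
    Definable 𝓜 (fun e => S.InDomF (d e)) :=
  .congr (fun e => ∃ z, pair (d e) z ∈ S.cF) fun _ => Iff.rfl

variable (𝓜) in
theorem cond_mem_sets (p : S.Cond) : p.1 ∈ 𝓜.sets := mem_sets_of_mem_class hS.out.P_class p.2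

theorem app_mem_sets (d : ZFSet.{u}) {p : ZFSet.{u}} (hp : p ∈ 𝓜.sets) : S.app d p ∈ 𝓜.sets := by
  unfold SystemData.app
  split_ifs with h
  · exact cond_mem_sets 𝓜 _
  · exact hp

variable (𝓜) in
omit [KelleyMorse 𝓜] in
include hS in
theorem eq_app_iff {d p q : ZFSet.{u}} : q = S.app d p ↔
    (p ∈ S.P ∧ S.InDomG d ∧ pair d (pair p q) ∈ S.cG) ∨ (¬ (p ∈ S.P ∧ S.InDomG d) ∧ q = p) := by
  by_cases hp : p ∈ S.P
  · by_cases hd : S.InDomG d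
    · simp only [hp, hd, true_and, not_true, false_and, or_false]
      rw [S.app_of_mem d ⟨p, hp⟩]
      constructor
      · rintro rfl
        exact ((isPerm_permOf 𝓜 hd).2 ⟨p, hp⟩ _).2 rfl
      · intro h
        obtain ⟨a, -, p', -, q', hq', e⟩ := hS.out.cG_sub _ h
        obtain ⟨-, e⟩ := ZFSet.pair_inj.1 e
        obtain ⟨-, rfl⟩ := ZFSet.pair_inj.1 e
        exact congrArg Subtype.val (((isPerm_permOf 𝓜 hd).2 ⟨p, hp⟩ ⟨q, hq'⟩).1 h).symm
    · simp only [hp, hd, and_false, not_false_eq_true, true_and]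
      rw [S.app_of_mem d ⟨p, hp⟩, SystemData.permOf_of_not hd]
      simp
  · simp [hp, SystemData.app]

instance SetTerm.app {d p : E → ZFSet.{u}} [hd : SetTerm 𝓜 d] [hp : SetTerm 𝓜 p] :
    SetTerm 𝓜 (fun e => S.app (d e) (p e)) := by
  have := hd.comp (.fstSet (E := E))
  have := hp.comp (.fstSet (E := E))
  exact .of_graph (fun e => app_mem_sets _ (hp.mem_sets e))
    (.congr (fun e : E × 𝓜.sets => (p e.1 ∈ S.P ∧ S.InDomG (d e.1) ∧
      ZFSet.pair (d e.1) (ZFSet.pair (p e.1) e.2.1) ∈ S.cG) ∨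
        (¬ (p e.1 ∈ S.P ∧ S.InDomG (d e.1)) ∧ e.2.1 = p e.1)) fun _ => eq_app_iff 𝓜)

theorem mem_act_permOf {d x z : ZFSet.{u}} : z ∈ act (S.permOf d) x ↔
    ∃ y p, pair y p ∈ x ∧ p ∈ S.P ∧ z = pair (act (S.permOf d) y) (S.app d p) := by
  rw [mem_act]
  constructor
  · rintro ⟨y, p, h, rfl⟩
    exact ⟨y, p.1, h, p.2, by rw [S.app_of_mem]⟩
  · rintro ⟨y, p, h, hp, rfl⟩
    exact ⟨y, ⟨p, hp⟩, h, by rw [← S.app_of_mem]⟩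

end Definability

/-! ### Definability of the action -/

section ActionDefinability

variable {𝓜 : ClassModel.{u}} [KelleyMorse 𝓜] {S : SystemData.{u}}
  [hS : Fact (IsSymmetricSystem 𝓜 S)] {E : Type v} [Ctx 𝓜 E]

variable (𝓜 S) in
/-- The graph of the action on sets is a class, being determined by a monotone recursive clause. -/
theorem exists_act_graph : ∃ R ∈ 𝓜.classes, ∀ d ∈ 𝓜.sets, ∀ x ∈ 𝓜.sets,
    act (S.permOf d) x ∈ 𝓜.sets ∧
      ∀ y ∈ 𝓜.sets, (pair d (pair x y) ∈ R ↔ y = act (S.permOf d) x) := by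
  obtain ⟨R, hR, h⟩ := exists_fixedPoint (𝓜 := 𝓜) (fun R t => ∃ d ∈ 𝓜.sets, ∃ x ∈ 𝓜.sets,
    ∃ y ∈ 𝓜.sets, t = pair d (pair x y) ∧
      (∀ x' p, pair x' p ∈ x → p ∈ S.P → ∃ y' ∈ 𝓜.sets, pair y' (S.app d p) ∈ y ∧
        pair d (pair x' y') ∈ R) ∧
      (∀ z ∈ y, ∃ x' p, pair x' p ∈ x ∧ p ∈ S.P ∧ ∃ y' ∈ 𝓜.sets, z = pair y' (S.app d p) ∧
        pair d (pair x' y') ∈ R)) (by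
    rintro R - R' - hRR' t ⟨d, hd, x, hx, y, hy, rfl, h1, h2⟩
    refine ⟨d, hd, x, hx, y, hy, rfl, fun x' p hp hp' => ?_, fun z hz => ?_⟩
    · obtain ⟨y', hy', h, h'⟩ := h1 x' p hp hp'
      exact ⟨y', hy', h, hRR' h'⟩
    · obtain ⟨x', p, hp, hp', y', hy', h, h'⟩ := h2 z hz
      exact ⟨x', p, hp, hp', y', hy', h, hRR' h'⟩)
  have hRp : ∀ d ∈ 𝓜.sets, ∀ x ∈ 𝓜.sets, ∀ y ∈ 𝓜.sets, (pair d (pair x y) ∈ R ↔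
      (∀ x' p, pair x' p ∈ x → p ∈ S.P → ∃ y' ∈ 𝓜.sets, pair y' (S.app d p) ∈ y ∧
        pair d (pair x' y') ∈ R) ∧
      (∀ z ∈ y, ∃ x' p, pair x' p ∈ x ∧ p ∈ S.P ∧ ∃ y' ∈ 𝓜.sets, z = pair y' (S.app d p) ∧
        pair d (pair x' y') ∈ R)) := by
    intro d hd x hx y hy
    rw [h _ (pair_mem_sets hd (pair_mem_sets hx hy))]
    constructor
    · rintro ⟨d', -, x', -, y', -, e, h⟩
      obtain ⟨rfl, e'⟩ := ZFSet.pair_inj.1 e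
      obtain ⟨rfl, rfl⟩ := ZFSet.pair_inj.1 e'
      exact h
    · exact fun h => ⟨d, hd, x, hx, y, hy, rfl, h⟩
  refine ⟨R, hR, fun d hd x => ?_⟩
  induction hr : x.rank using WellFoundedLT.induction generalizing x with
  | ind r ih =>
    subst hr
    intro hx
    have ih' : ∀ x' p, pair x' p ∈ x → act (S.permOf d) x' ∈ 𝓜.sets ∧
        ∀ y ∈ 𝓜.sets, (pair d (pair x' y) ∈ R ↔ y = act (S.permOf d) x') := fun x' p h' =>
      ih _ (rank_lt_of_pair_mem h') x' rfl (of_pair_mem_sets (mem_sets_of_mem hx h')).1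
    constructor
    · -- `act π x` is the image of `x` under the definable partial function
      -- `⟨y, p⟩ ↦ ⟨act π y, π p⟩`, whose values lie in the model by the induction hypothesis
      have : IsClass 𝓜 R := ⟨hR⟩
      have : IsSet 𝓜 d := ⟨hd⟩
      obtain ⟨b, hb, hbz⟩ := exists_image (𝓜 := 𝓜) (fun z w => ∃ y ∈ 𝓜.sets, ∃ p ∈ S.P,
        z = pair y p ∧ ∃ y' ∈ 𝓜.sets, pair d (pair y y') ∈ R ∧ w = pair y' (S.app d p)) hx (by
        rintro _ hz w hw w' hw' ⟨y, hy, p, hp, rfl, y', hy', h1, rfl⟩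
          ⟨y₁, hy₁, p₁, hp₁, e, y₁', hy₁', h2, rfl⟩
        obtain ⟨rfl, rfl⟩ := ZFSet.pair_inj.1 e
        rw [((ih' y p hz).2 y' hy').1 h1, ((ih' y p hz).2 y₁' hy₁').1 h2])
      have : act (S.permOf d) x = b := by
        ext w
        rw [mem_act_permOf, hbz]
        constructor
        · rintro ⟨y, p, h, hp, rfl⟩
          have hyp := of_pair_mem_sets (mem_sets_of_mem hx h)
          have ha := (ih' y p h).1
          exact ⟨pair_mem_sets ha (app_mem_sets (𝓜 := 𝓜) d hyp.2), _, h, y, hyp.1, p, hp, rfl, _, ha,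
            ((ih' y p h).2 _ ha).2 rfl, rfl⟩
        · rintro ⟨-, z, hz, y, hy, p, hp, rfl, y', hy', h1, rfl⟩
          exact ⟨y, p, hz, hp, by rw [((ih' y p hz).2 y' hy').1 h1]⟩
      exact this ▸ hb
    · intro y hy
      rw [hRp d hd x hx y hy]
      constructor
      · rintro ⟨h1, h2⟩
        ext z
        rw [mem_act_permOf]
        constructor
        · intro hz
          obtain ⟨x', p, h, hp, y', hy', rfl, hR'⟩ := h2 z hz
          exact ⟨x', p, h, hp, by rw [((ih' x' p h).2 y' hy').1 hR']⟩
        · rintro ⟨x', p, h, hp, rfl⟩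
          obtain ⟨y', hy', hy'', hR'⟩ := h1 x' p h hp
          rwa [← ((ih' x' p h).2 y' hy').1 hR']
      · rintro rfl
        refine ⟨fun x' p h hp => ?_, fun z hz => ?_⟩
        · exact ⟨_, (ih' x' p h).1, mem_act_permOf.2 ⟨x', p, h, hp, rfl⟩,
            ((ih' x' p h).2 _ (ih' x' p h).1).2 rfl⟩
        · obtain ⟨x', p, h, hp, rfl⟩ := mem_act_permOf.1 hz
          exact ⟨x', p, h, hp, _, (ih' x' p h).1, rfl, ((ih' x' p h).2 _ (ih' x' p h).1).2 rfl⟩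

theorem act_permOf_mem_sets {d x : ZFSet.{u}} (hd : d ∈ 𝓜.sets) (hx : x ∈ 𝓜.sets) :
    act (S.permOf d) x ∈ 𝓜.sets := by
  obtain ⟨R, -, h⟩ := exists_act_graph 𝓜 S
  exact (h d hd x hx).1

instance SetTerm.act {d x : E → ZFSet.{u}} [hd : SetTerm 𝓜 d] [hx : SetTerm 𝓜 x] :
    SetTerm 𝓜 (fun e => act (S.permOf (d e)) (x e)) := by
  obtain ⟨R, hR, h⟩ := exists_act_graph 𝓜 S
  have : IsClass 𝓜 R := ⟨hR⟩
  have := hd.comp (.fstSet (E := E))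
  have := hx.comp (.fstSet (E := E))
  exact .of_graph (fun e => (h _ (hd.mem_sets e) _ (hx.mem_sets e)).1)
    (.congr (fun e : E × 𝓜.sets => ZFSet.pair (d e.1) (ZFSet.pair (x e.1) e.2.1) ∈ R)
      fun e => ((h _ (hd.mem_sets _) _ (hx.mem_sets _)).2 _ e.2.2).symm)

instance ClassTerm.act {d x : E → ZFSet.{u}} [hd : SetTerm 𝓜 d] [hx : ClassTerm 𝓜 x] :
    ClassTerm 𝓜 (fun e => act (S.permOf (d e)) (x e)) := by
  have := hd.comp (.fstSet (E := E))
  have := (hd.comp (.fstSet (E := E))).comp (.fstSet (E := E × 𝓜.sets))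
  have := ((hd.comp (.fstSet (E := E))).comp (.fstSet (E := E × 𝓜.sets))).comp
    (.fstSet (E := (E × 𝓜.sets) × 𝓜.sets))
  have := hx.comp (.fstSet (E := E))
  refine .of_mem (fun e z hz => ?_) (.congr (fun e : E × 𝓜.sets => ∃ y p, pair y p ∈ x e.1 ∧
    p ∈ S.P ∧ e.2.1 = pair (ClassForcing.act (S.permOf (d e.1)) y) (S.app (d e.1) p))
      fun _ => mem_act_permOf)
  obtain ⟨y, p, h, -, rfl⟩ := mem_act_permOf.1 hz
  obtain ⟨hy, hp⟩ := of_pair_mem_sets (mem_sets_of_mem_class (hx.mem e) h)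
  exact pair_mem_sets (act_permOf_mem_sets (hd.mem_sets e) hy) (app_mem_sets _ hp)

end ActionDefinability

/-! ### Hereditarily symmetric names -/

section HereditarilySymmetric

variable {𝓜 : ClassModel.{u}} [KelleyMorse 𝓜] {S : SystemData.{u}}
  [hS : Fact (IsSymmetricSystem 𝓜 S)] {E : Type v} [Ctx 𝓜 E]

/-- A definable subgroup of `𝒢` that includes a group of the base belongs to the filter. -/
theorem inFilter_of_base (Q : S.Aut → Prop)
    [Definable 𝓜 (fun e : EmptyEnv.{u} × 𝓜.sets => Q (S.permOf e.2.1))] (one : Q 1)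
    (mul : ∀ π σ, Q π → Q σ → Q (π * σ)) (inv : ∀ π, Q π → Q π⁻¹) {a : ZFSet.{u}}
    (ha : S.InDomF a) (h : ∀ d, pair a d ∈ S.cF → Q (S.permOf d)) :
    InFilter 𝓜 S {π | π ∈ S.group ∧ Q π} := by
  refine ⟨⟨{ carrier := {π | π ∈ S.group ∧ Q π}
             one_mem' := ⟨one_mem_group 𝓜, one⟩
             mul_mem' := fun h h' => ⟨mul_mem_group 𝓜 h.1 h'.1, mul _ _ h.2 h'.2⟩
             inv_mem' := fun h => ⟨inv_mem_group 𝓜 h.1, inv _ h.2⟩ }, rfl⟩, ?_, a, ha, ?_⟩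
  · obtain ⟨C, hC, hCz⟩ := Definable.comprehension (𝓜 := 𝓜)
      (Q := fun (_ : EmptyEnv.{u}) d => S.InDomG d ∧ Q (S.permOf d)) inferInstance Fin.elim0
    refine ⟨C, hC, fun b hb => ((hCz b).1 hb).2.1, Set.ext fun π => ?_⟩
    constructor
    · rintro ⟨hπ, hQ⟩
      obtain ⟨d, hd, rfl⟩ := (mem_group 𝓜).1 hπ
      obtain ⟨z, hz⟩ := hd
      refine ⟨d, (hCz d).2 ⟨?_, ⟨z, hz⟩, hQ⟩, isPerm_permOf 𝓜 ⟨z, hz⟩⟩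
      exact (of_pair_mem_sets (mem_sets_of_mem_class hS.out.cG_class hz)).1
    · rintro ⟨d, hd, hπ⟩
      obtain ⟨-, -, hQ⟩ := (hCz d).1 hd
      rw [hπ.unique (isPerm_permOf 𝓜 hπ.1)]
      exact ⟨(mem_group 𝓜).2 ⟨d, hπ.1, rfl⟩, hQ⟩
  · intro π hπ
    obtain ⟨d, hd, rfl⟩ := (mem_baseGroup 𝓜).1 hπ
    exact ⟨S.baseGroup_subset_group a hπ, h d hd⟩

omit [KelleyMorse 𝓜] hS in
theorem IsHSName.isName {x : ZFSet.{u}} (h : IsHSName 𝓜 S x) : IsName S.P x := by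
  cases h with
  | intro _ name _ _ => exact name

omit [KelleyMorse 𝓜] hS in
theorem IsHSName.of_pair_mem {x y p : ZFSet.{u}} (h : IsHSName 𝓜 S x) (hy : pair y p ∈ x) :
    IsHSName 𝓜 S y := by
  cases h with
  | intro _ _ _ hered => exact hered y p hy

omit [KelleyMorse 𝓜] in
theorem IsHSName.exists_base {x : ZFSet.{u}} (h : IsHSName 𝓜 S x) :
    ∃ a, S.InDomF a ∧ ∀ d, pair a d ∈ S.cF → act (S.permOf d) x = x := by
  cases h with
  | intro _ _ symm _ =>
    obtain ⟨-, -, a, ha, h⟩ := symm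
    exact ⟨a, ha, fun d hd => (h ((mem_baseGroup 𝓜).2 ⟨d, hd, rfl⟩)).2⟩

variable (𝓜 S) in
theorem isHSName_iff {x : ZFSet.{u}} (hx : x ∈ 𝓜.classes) : IsHSName 𝓜 S x ↔
    (∀ z ∈ x, ∃ y ∈ 𝓜.sets, ∃ p ∈ S.P, z = pair y p ∧ IsHSName 𝓜 S y) ∧
      ∃ a ∈ 𝓜.sets, S.InDomF a ∧ ∀ d, pair a d ∈ S.cF → act (S.permOf d) x = x := by
  constructor
  · intro h
    refine ⟨fun z hz => ?_, ?_⟩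
    · obtain ⟨y, p, rfl, -⟩ := h.isName.exists_eq_pair hz
      exact ⟨y, (of_pair_mem_sets (mem_sets_of_mem_class hx hz)).1, p.1, p.2, rfl,
        h.of_pair_mem hz⟩
    · obtain ⟨a, ⟨d, hd⟩, h⟩ := h.exists_base
      exact ⟨a, (of_pair_mem_sets (mem_sets_of_mem_class hS.out.cF_class hd)).1, ⟨d, hd⟩, h⟩
  · rintro ⟨h1, a, -, ha, h2⟩
    have hered : ∀ y p, pair y p ∈ x → IsHSName 𝓜 S y := by
      intro y p hy
      obtain ⟨y', -, p', hp', e, h⟩ := h1 _ hy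
      rwa [(ZFSet.pair_inj.1 e).1]
    have name : IsName S.P x := .intro x (fun z hz => by
      obtain ⟨y, -, p, hp, e, -⟩ := h1 z hz
      exact ⟨y, p, hp, e⟩) fun y p hy => (hered y p hy).isName
    have : IsClass 𝓜 x := ⟨hx⟩
    refine .intro x name (inFilter_of_base (fun π => act π x = x) (act_one name) ?_ ?_ ha h2) hered
    · intro π σ hπ hσ
      rw [act_mul, hσ, hπ]
    · intro π hπ
      nth_rw 1 [← hπ]
      exact act_inv_act name π

variable (𝓜 S) in
theorem exists_hsName_class : ∃ R ∈ 𝓜.classes, ∀ x ∈ 𝓜.sets, (x ∈ R ↔ IsHSName 𝓜 S x) := by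
  obtain ⟨R, hR, h⟩ := exists_fixedPoint (𝓜 := 𝓜) (fun R x =>
    (∀ z ∈ x, ∃ y ∈ 𝓜.sets, ∃ p ∈ S.P, z = pair y p ∧ y ∈ R) ∧
      ∃ a ∈ 𝓜.sets, S.InDomF a ∧ ∀ d, pair a d ∈ S.cF → act (S.permOf d) x = x) (by
    rintro R - R' - hRR' x ⟨h1, h2⟩
    refine ⟨fun z hz => ?_, h2⟩
    obtain ⟨y, hy, p, hp, e, h⟩ := h1 z hz
    exact ⟨y, hy, p, hp, e, hRR' h⟩)
  refine ⟨R, hR, fun x => ?_⟩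
  induction hr : x.rank using WellFoundedLT.induction generalizing x with
  | ind r ih =>
    subst hr
    intro hx
    rw [h x hx, isHSName_iff 𝓜 S (sets_subset_classes hx)]
    refine and_congr_left fun _ => forall₂_congr fun z hz => exists_congr fun y =>
      and_congr_right fun hy => exists_congr fun p => and_congr_right fun _ =>
      and_congr_right fun e => ?_
    subst e
    exact ih _ (rank_lt_of_pair_mem hz) y rfl hy

instance Definable.isHSName {x : E → ZFSet.{u}} [hx : ClassTerm 𝓜 x] :
    Definable 𝓜 (fun e => IsHSName 𝓜 S (x e)) := by
  obtain ⟨R, hR, h⟩ := exists_hsName_class 𝓜 S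
  have : IsClass 𝓜 R := ⟨hR⟩
  have := hx.comp (.fstSet (E := E))
  have := (hx.comp (.fstSet (E := E))).comp (.fstSet (E := E × 𝓜.sets))
  refine .congr (fun e => (∀ z ∈ x e, ∃ y ∈ 𝓜.sets, ∃ p ∈ S.P, z = pair y p ∧ y ∈ R) ∧
    ∃ a ∈ 𝓜.sets, S.InDomF a ∧ ∀ d, pair a d ∈ S.cF → act (S.permOf d) (x e) = x e) fun e => ?_
  rw [isHSName_iff 𝓜 S (hx.mem e)]
  refine and_congr_left fun _ => forall₂_congr fun z hz => exists_congr fun y =>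
      and_congr_right fun hy => exists_congr fun p => and_congr_right fun _ =>
      and_congr_right fun _ => ?_
  rw [h y hy]

theorem act_mem_sets {π : S.Aut} (hπ : π ∈ S.group) {x : ZFSet.{u}} (hx : x ∈ 𝓜.sets) :
    act π x ∈ 𝓜.sets := by
  obtain ⟨d, ⟨z, hz⟩, rfl⟩ := (mem_group 𝓜).1 hπ
  exact act_permOf_mem_sets
    (of_pair_mem_sets (mem_sets_of_mem_class hS.out.cG_class hz)).1 hx

theorem act_mem_classes {π : S.Aut} (hπ : π ∈ S.group) {x : ZFSet.{u}} (hx : x ∈ 𝓜.classes) :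
    act π x ∈ 𝓜.classes := by
  obtain ⟨d, ⟨z, hz⟩, rfl⟩ := (mem_group 𝓜).1 hπ
  have : IsClass 𝓜 x := ⟨hx⟩
  have : IsSet 𝓜 d := ⟨(of_pair_mem_sets (mem_sets_of_mem_class hS.out.cG_class hz)).1⟩
  exact (inferInstance : ClassTerm 𝓜 (fun _ : EmptyEnv.{u} => act (S.permOf d) x)).mem Fin.elim0

/-- The action maps hereditarily symmetric names to such names, because the filter is normal. -/
theorem isHSName_act {π : S.Aut} (hπ : π ∈ S.group) {x : ZFSet.{u}} (hx : x ∈ 𝓜.classes)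
    (h : IsHSName 𝓜 S x) : IsHSName 𝓜 S (act π x) := by
  induction hr : x.rank using WellFoundedLT.induction generalizing x with
  | ind r ih =>
    subst hr
    rw [isHSName_iff 𝓜 S (act_mem_classes hπ hx)]
    constructor
    · intro z hz
      obtain ⟨y, p, hy, rfl⟩ := mem_act.1 hz
      have hy' := (of_pair_mem_sets (mem_sets_of_mem_class hx hy)).1
      exact ⟨_, act_mem_sets hπ hy', _, (π p).2, rfl,
        ih _ (rank_lt_of_pair_mem hy) (sets_subset_classes hy') (h.of_pair_mem hy) rfl⟩
    · obtain ⟨a, ha, hax⟩ := h.exists_base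
      obtain ⟨c, hc, hca⟩ := hS.out.normal a ha π hπ
      have hc' := hc
      obtain ⟨d, hd⟩ := hc'
      refine ⟨c, (of_pair_mem_sets (mem_sets_of_mem_class hS.out.cF_class hd)).1, hc, ?_⟩
      intro d hd
      obtain ⟨σ, hσ, e⟩ := hca ((mem_baseGroup 𝓜).2 ⟨d, hd, rfl⟩)
      obtain ⟨d', hd', rfl⟩ := (mem_baseGroup 𝓜).1 hσ
      rw [e, ← act_mul, inv_mul_cancel_right, act_mul, hax d' hd']

end HereditarilySymmetric

/-! ### Generic filters decide definable symmetric properties -/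

section Generic

variable {𝓜 : ClassModel.{u}} [KelleyMorse 𝓜] {S : SystemData.{u}}
  [hS : Fact (IsSymmetricSystem 𝓜 S)]

omit hS [KelleyMorse 𝓜] in
theorem image_eq_self_iff (π : S.Aut) (s : Set S.Cond) : π '' s = s ↔ ∀ p, p ∈ s ↔ π p ∈ s := by
  constructor
  · intro h p
    nth_rw 2 [← h]
    exact (π.injective.mem_set_image).symm
  · intro h
    ext q
    constructor
    · rintro ⟨p, hp, rfl⟩
      exact (h p).1 hp
    · intro hq
      obtain ⟨p, rfl⟩ := π.surjective q
      exact ⟨p, (h p).2 hq, rfl⟩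

/-- A generic filter decides every definable symmetric property `Q` of conditions: it contains a
condition that has `Q` or no extension of which has `Q`. -/
theorem IsGeneric.exists_decides {G : Set ZFSet.{u}} (hG : IsGeneric 𝓜 S G) (Q : ZFSet.{u} → Prop)
    [Definable 𝓜 (fun e : EmptyEnv.{u} × 𝓜.sets => Q e.2.1)] {a : ZFSet.{u}} (ha : S.InDomF a)
    (hQ : ∀ d, pair a d ∈ S.cF → ∀ p : S.Cond, Q p.1 ↔ Q (S.permOf d p).1) :
    ∃ r : S.Cond, r.1 ∈ G ∧ (Q r.1 ∨ ∀ q : S.Cond, S.Le q r → ¬ Q q.1) := by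
  obtain ⟨A, hA, hAz⟩ := Definable.comprehension (𝓜 := 𝓜)
    (Q := fun (_ : EmptyEnv.{u}) p => p ∈ S.P ∧ Q p) inferInstance Fin.elim0
  have : IsClass 𝓜 A := ⟨hA⟩
  obtain ⟨D, hD, hDz⟩ := Definable.comprehension (𝓜 := 𝓜)
    (Q := fun (_ : EmptyEnv.{u}) p => p ∈ S.P ∧ (p ∈ A ∨ ∀ q ∈ S.P, pair q p ∈ S.le → q ∉ A))
    inferInstance Fin.elim0
  have : IsClass 𝓜 D := ⟨hD⟩
  -- `D` consists of the conditions that have `Q` or no extension of which has `Q`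
  have hAp : ∀ p : S.Cond, p.1 ∈ A ↔ Q p.1 := fun p => by
    simp [hAz, p.2, cond_mem_sets 𝓜 p]
  have hDp : ∀ p : S.Cond, p.1 ∈ D ↔ Q p.1 ∨ ∀ q : S.Cond, S.Le q p → ¬ Q q.1 := by
    intro p
    rw [hDz, hAp, and_iff_right (cond_mem_sets 𝓜 p), and_iff_right p.2]
    refine or_congr Iff.rfl ⟨fun h q hq => ?_, fun h q hq hqp => ?_⟩
    · exact fun hq' => h q.1 q.2 hq ((hAp q).2 hq')
    · exact fun hq' => h ⟨q, hq⟩ hqp ((hAp ⟨q, hq⟩).1 hq')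
  have hs : IsSymmetricSubset 𝓜 S D := ⟨fun p hp => ((hDz p).1 hp).2.1, ?_⟩
  have hd : IsDense S D := ⟨fun p hp => ((hDz p).1 hp).2.1, fun p => ?_⟩
  · obtain ⟨p, hpD, hpG⟩ := hG.meets D hD hd hs
    exact ⟨⟨p, hG.filter.sub p hpG⟩, hpG, (hDp _).1 hpD⟩
  · by_cases h : ∃ q : S.Cond, S.Le q p ∧ Q q.1
    · obtain ⟨q, hqp, hq⟩ := h
      exact ⟨q, (hDp q).2 (Or.inl hq), hqp⟩
    · push Not at h
      exact ⟨p, (hDp p).2 (Or.inr h), hS.out.le_refl p⟩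
  · simp only [image_eq_self_iff]
    have : Definable 𝓜 (fun e : EmptyEnv.{u} × 𝓜.sets => ∀ p : S.Cond,
        p ∈ {p : S.Cond | p.1 ∈ D} ↔ S.permOf e.2.1 p ∈ {p : S.Cond | p.1 ∈ D}) := by
      refine .congr (fun e => ∀ p ∈ S.P, (p ∈ D ↔ S.app e.2.1 p ∈ D)) fun e => ?_
      simp only [Subtype.forall, Set.mem_ofPred_eq]
      refine forall₂_congr fun p hp => ?_
      rw [S.app_of_mem _ ⟨p, hp⟩]
    refine inFilter_of_base (fun π : S.Aut => ∀ p : S.Cond,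
        p ∈ {p : S.Cond | p.1 ∈ D} ↔ π p ∈ {p : S.Cond | p.1 ∈ D}) (fun p => Iff.rfl) ?_ ?_ ha ?_
    · exact fun π σ h h' p => (h' p).trans (h (σ p))
    · intro π h p
      rw [h (π⁻¹ p), RelIso.apply_inv_self]
    · intro d hd p
      simp only [Set.mem_ofPred_eq, hDp, ← hQ d hd p]
      refine or_congr Iff.rfl ⟨fun h q hq => ?_, fun h q hq => ?_⟩
      · obtain ⟨q, rfl⟩ := (S.permOf d).surjective q
        rw [← hQ d hd]
        exact h q ((S.permOf d).map_rel_iff.1 hq)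
      · rw [hQ d hd]
        exact h _ ((S.permOf d).map_rel_iff.2 hq)

end Generic

/-! ### Forcing equality and membership of names -/

section ForcingEquality

/-- `q` is a condition stronger than the condition `p`. -/
abbrev SystemData.Ext (S : SystemData.{u}) (q p : ZFSet.{u}) : Prop := pair q p ∈ S.le

/-- The forcing relation `p ⊩ x = y` for names: densely below `p`, every element of `x` is forced
to equal an element of `y`, and conversely. -/
def ForcesEq (S : SystemData.{u}) (p x y : ZFSet.{u}) : Prop :=
  ∀ q, S.Ext q p →
    (∀ x' s, pair x' s ∈ x → S.Ext q s →
      ∃ r, S.Ext r q ∧ ∃ y' t, pair y' t ∈ y ∧ S.Ext r t ∧ ForcesEq S r x' y') ∧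
    (∀ y' t, pair y' t ∈ y → S.Ext q t →
      ∃ r, S.Ext r q ∧ ∃ x' s, ∃ _ : pair x' s ∈ x, S.Ext r s ∧ ForcesEq S r x' y')
termination_by x.rank
decreasing_by all_goals exact rank_lt_of_pair_mem ‹_›

/-- The strong forcing relation `p ⊩ x ∈ y` for names. -/
def ForcesMem (S : SystemData.{u}) (p x y : ZFSet.{u}) : Prop :=
  ∃ y' t, pair y' t ∈ y ∧ S.Ext p t ∧ ForcesEq S p x y'

/-- The forcing relation `p ⊩ x ⊆ y` for names. -/
def ForcesSub (S : SystemData.{u}) (p x y : ZFSet.{u}) : Prop :=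
  ∀ q, S.Ext q p → ∀ x' s, pair x' s ∈ x → S.Ext q s → ∃ r, S.Ext r q ∧ ForcesMem S r x' y

variable {S : SystemData.{u}}

theorem forcesEq_comm {p x y : ZFSet.{u}} : ForcesEq S p x y ↔ ForcesEq S p y x := by
  induction hr : x.rank using WellFoundedLT.induction generalizing p x y with
  | ind r ih =>
    subst hr
    have ih' : ∀ x' s, pair x' s ∈ x → ∀ q y', ForcesEq S q x' y' ↔ ForcesEq S q y' x' :=
      fun x' s h q y' => ih _ (rank_lt_of_pair_mem h) rfl
    rw [ForcesEq, ForcesEq]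
    refine forall₂_congr fun q _ => and_comm.trans (and_congr ?_ ?_)
    · refine forall₄_congr fun y' t _ _ => exists_congr fun r => and_congr_right fun _ =>
        exists₂_congr fun x' s => ?_
      rw [exists_prop]
      exact and_congr_right fun h => and_congr_right fun _ => ih' x' s h _ _
    · refine forall₄_congr fun x' s h _ => exists_congr fun r => and_congr_right fun _ =>
        exists₂_congr fun y' t => ?_
      rw [exists_prop]
      exact and_congr_right fun _ => and_congr_right fun _ => ih' x' s h _ _

theorem forcesEq_iff {p x y : ZFSet.{u}} :
    ForcesEq S p x y ↔ ForcesSub S p x y ∧ ForcesSub S p y x := by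
  rw [ForcesEq]
  simp only [forall_and, ForcesSub, ForcesMem, exists_prop]
  constructor
  · rintro ⟨h1, h2⟩
    refine ⟨h1, fun q hq y' t h hqt => ?_⟩
    obtain ⟨r, hr, x', s, hx, hrs, hF⟩ := h2 q hq y' t h hqt
    exact ⟨r, hr, x', s, hx, hrs, forcesEq_comm.1 hF⟩
  · rintro ⟨h1, h2⟩
    refine ⟨h1, fun q hq y' t h hqt => ?_⟩
    obtain ⟨r, hr, x', s, hx, hrs, hF⟩ := h2 q hq y' t h hqt
    exact ⟨r, hr, x', s, hx, hrs, forcesEq_comm.1 hF⟩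

theorem ext_map (π : S.Aut) {q p : S.Cond} : S.Ext (π q).1 (π p).1 ↔ S.Ext q.1 p.1 :=
  π.map_rel_iff

end ForcingEquality

section ExtAction

variable (𝓜 : ClassModel.{u}) {S : SystemData.{u}} [hS : Fact (IsSymmetricSystem 𝓜 S)]

include hS

theorem ext_mem {q p : ZFSet.{u}} (h : S.Ext q p) : q ∈ S.P ∧ p ∈ S.P := by
  obtain ⟨q', hq, p', hp, e⟩ := hS.out.le_sub _ h
  obtain ⟨rfl, rfl⟩ := ZFSet.pair_inj.1 e
  exact ⟨hq, hp⟩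

theorem ext_trans {r q p : ZFSet.{u}} (h : S.Ext r q) (h' : S.Ext q p) : S.Ext r p :=
  hS.out.le_trans ⟨r, (ext_mem 𝓜 h).1⟩ ⟨q, (ext_mem 𝓜 h).2⟩ ⟨p, (ext_mem 𝓜 h').2⟩ h h'

theorem ForcesEq.mono {p q x y : ZFSet.{u}} (h : ForcesEq S p x y) (hq : S.Ext q p) :
    ForcesEq S q x y := by
  rw [ForcesEq] at h ⊢
  exact fun r hr => h r (ext_trans 𝓜 hr hq)

theorem ForcesMem.mono {p q x y : ZFSet.{u}} (h : ForcesMem S p x y) (hq : S.Ext q p) :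
    ForcesMem S q x y := by
  obtain ⟨y', t, hy, ht, h⟩ := h
  exact ⟨y', t, hy, ext_trans 𝓜 hq ht, h.mono 𝓜 hq⟩

theorem ForcesSub.mono {p q x y : ZFSet.{u}} (h : ForcesSub S p x y) (hq : S.Ext q p) :
    ForcesSub S q x y :=
  fun r hr => h r (ext_trans 𝓜 hr hq)

theorem forcesEq_act {p : S.Cond} {x y : ZFSet.{u}} (π : S.Aut)
    (h : ForcesEq S p.1 x y) : ForcesEq S (π p).1 (act π x) (act π y) := by
  induction hr : x.rank using WellFoundedLT.induction generalizing p x y with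
  | ind r ih =>
    subst hr
    rw [ForcesEq] at h ⊢
    intro q' hq
    obtain ⟨q, hq'⟩ := π.surjective ⟨q', (ext_mem 𝓜 hq).1⟩
    obtain rfl : (π q).1 = q' := congrArg Subtype.val hq'
    obtain ⟨h1, h2⟩ := h q.1 ((ext_map π).1 hq)
    constructor
    · intro x₁ s₁ hx hs
      obtain ⟨x', s, hx', e⟩ := mem_act.1 hx
      obtain ⟨rfl, rfl⟩ := ZFSet.pair_inj.1 e
      obtain ⟨r, hr, y', t, hy, hrt, hF⟩ := h1 x' s hx' ((ext_map π).1 hs)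
      have hrP := (ext_mem 𝓜 hr).1
      have htP := (ext_mem 𝓜 hrt).2
      exact ⟨_, (ext_map π (q := ⟨r, hrP⟩)).2 hr, _, _, pair_mem_act (p := ⟨t, htP⟩) π hy,
        (ext_map π (q := ⟨r, hrP⟩) (p := ⟨t, htP⟩)).2 hrt,
        ih _ (rank_lt_of_pair_mem hx') (p := ⟨r, hrP⟩) hF rfl⟩
    · intro y₁ t₁ hy ht
      obtain ⟨y', t, hy', e⟩ := mem_act.1 hy
      obtain ⟨rfl, rfl⟩ := ZFSet.pair_inj.1 e
      obtain ⟨r, hr, x', s, hx, hrs, hF⟩ := h2 y' t hy' ((ext_map π).1 ht)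
      have hrP := (ext_mem 𝓜 hr).1
      have hsP := (ext_mem 𝓜 hrs).2
      exact ⟨_, (ext_map π (q := ⟨r, hrP⟩)).2 hr, _, _, pair_mem_act (p := ⟨s, hsP⟩) π hx,
        (ext_map π (q := ⟨r, hrP⟩) (p := ⟨s, hsP⟩)).2 hrs,
        ih _ (rank_lt_of_pair_mem hx) (p := ⟨r, hrP⟩) hF rfl⟩

theorem forcesMem_act {p : S.Cond} {x y : ZFSet.{u}} (π : S.Aut) (h : ForcesMem S p.1 x y) :
    ForcesMem S (π p).1 (act π x) (act π y) := by
  obtain ⟨y', t, hy, ht, h⟩ := h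
  have htP := (ext_mem 𝓜 ht).2
  exact ⟨_, _, pair_mem_act (p := ⟨t, htP⟩) π hy, (ext_map π (p := ⟨t, htP⟩)).2 ht,
    forcesEq_act 𝓜 π h⟩

end ExtAction

section ExtInstances

variable {𝓜 : ClassModel.{u}} [KelleyMorse 𝓜] {S : SystemData.{u}}
  [hS : Fact (IsSymmetricSystem 𝓜 S)] {E : Type v} [Ctx 𝓜 E]

instance Definable.exPairMemRight {t s : E → ZFSet.{u}} {Q : E → ZFSet.{u} → Prop}
    [ht : SetTerm 𝓜 t] [hs : ClassTerm 𝓜 s]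
    [Definable 𝓜 (fun e : E × 𝓜.sets => Q e.1 e.2.1)] :
    Definable 𝓜 (fun e => ∃ z, pair z (t e) ∈ s e ∧ Q e z) := by
  have := ht.comp (.fstSet (E := E))
  have := hs.comp (.fstSet (E := E))
  exact .congr (fun e => ∃ z ∈ 𝓜.sets, pair z (t e) ∈ s e ∧ Q e z) fun e =>
    ⟨fun ⟨z, h, h'⟩ => ⟨z, (of_pair_mem_sets (mem_sets_of_mem_class (hs.mem e) h)).1, h, h'⟩,
      fun ⟨z, _, h⟩ => ⟨z, h⟩⟩

instance Definable.allPairMemRight {t s : E → ZFSet.{u}} {Q : E → ZFSet.{u} → Prop}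
    [ht : SetTerm 𝓜 t] [hs : ClassTerm 𝓜 s]
    [Definable 𝓜 (fun e : E × 𝓜.sets => Q e.1 e.2.1)] :
    Definable 𝓜 (fun e => ∀ z, pair z (t e) ∈ s e → Q e z) :=
  .congr (fun e => ¬ ∃ z, pair z (t e) ∈ s e ∧ ¬ Q e z)
    fun e => by simp only [not_exists, not_and, not_not]

variable (𝓜 S) in
/-- The relation `p ⊩ x = y` on sets is a class, being determined by a monotone recursive clause. -/
theorem exists_forcesEq_class : ∃ R ∈ 𝓜.classes, ∀ p ∈ 𝓜.sets, ∀ x ∈ 𝓜.sets, ∀ y ∈ 𝓜.sets,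
    (pair p (pair x y) ∈ R ↔ ForcesEq S p x y) := by
  obtain ⟨R, hR, h⟩ := exists_fixedPoint (𝓜 := 𝓜) (fun R z => ∃ p ∈ 𝓜.sets, ∃ x ∈ 𝓜.sets,
    ∃ y ∈ 𝓜.sets, z = pair p (pair x y) ∧ ∀ q, S.Ext q p →
      (∀ x' s, pair x' s ∈ x → S.Ext q s →
        ∃ r, S.Ext r q ∧ ∃ y' t, pair y' t ∈ y ∧ S.Ext r t ∧ pair r (pair x' y') ∈ R) ∧
      (∀ y' t, pair y' t ∈ y → S.Ext q t →
        ∃ r, S.Ext r q ∧ ∃ x' s, pair x' s ∈ x ∧ S.Ext r s ∧ pair r (pair x' y') ∈ R)) (by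
    rintro R - R' - hRR' z ⟨p, hp, x, hx, y, hy, rfl, h⟩
    refine ⟨p, hp, x, hx, y, hy, rfl, fun q hq => ⟨fun x' s h' hs => ?_, fun y' t h' ht => ?_⟩⟩
    · obtain ⟨r, hr, y', t, hy', ht, hR⟩ := (h q hq).1 x' s h' hs
      exact ⟨r, hr, y', t, hy', ht, hRR' hR⟩
    · obtain ⟨r, hr, x', s, hx', hs, hR⟩ := (h q hq).2 y' t h' ht
      exact ⟨r, hr, x', s, hx', hs, hRR' hR⟩)
  refine ⟨R, hR, fun p hp x => ?_⟩
  induction hr : x.rank using WellFoundedLT.induction generalizing p x with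
  | ind r ih =>
    subst hr
    intro hx y hy
    have hsets : ∀ {q p : ZFSet.{u}}, S.Ext q p → q ∈ 𝓜.sets := fun h =>
      (of_pair_mem_sets (mem_sets_of_mem_class hS.out.le_class h)).1
    have ih' : ∀ x' s, pair x' s ∈ x → ∀ r q, S.Ext r q → ∀ y' t, pair y' t ∈ y →
        (pair r (pair x' y') ∈ R ↔ ForcesEq S r x' y') := by
      intro x' s hx' r q hr y' t hy'
      exact ih _ (rank_lt_of_pair_mem hx') r (hsets hr) x' rfl
        (of_pair_mem_sets (mem_sets_of_mem hx hx')).1 y'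
        (of_pair_mem_sets (mem_sets_of_mem hy hy')).1
    rw [h _ (pair_mem_sets hp (pair_mem_sets hx hy)), ForcesEq]
    constructor
    · rintro ⟨p', -, x₁, -, y₁, -, e, h⟩ q hq
      obtain ⟨rfl, e'⟩ := ZFSet.pair_inj.1 e
      obtain ⟨rfl, rfl⟩ := ZFSet.pair_inj.1 e'
      refine ⟨fun x' s h' hs => ?_, fun y' t h' ht => ?_⟩
      · obtain ⟨r, hr, y', t, hy', ht, hR⟩ := (h q hq).1 x' s h' hs
        exact ⟨r, hr, y', t, hy', ht, (ih' x' s h' r q hr y' t hy').1 hR⟩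
      · obtain ⟨r, hr, x', s, hx', hs, hR⟩ := (h q hq).2 y' t h' ht
        exact ⟨r, hr, x', s, hx', hs, (ih' x' s hx' r q hr y' t h').1 hR⟩
    · refine fun h => ⟨p, hp, x, hx, y, hy, rfl, fun q hq =>
        ⟨fun x' s h' hs => ?_, fun y' t h' ht => ?_⟩⟩
      · obtain ⟨r, hr, y', t, hy', ht, hR⟩ := (h q hq).1 x' s h' hs
        exact ⟨r, hr, y', t, hy', ht, (ih' x' s h' r q hr y' t hy').2 hR⟩
      · obtain ⟨r, hr, x', s, hx', hs, hR⟩ := (h q hq).2 y' t h' ht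
        exact ⟨r, hr, x', s, hx', hs, (ih' x' s hx' r q hr y' t h').2 hR⟩

instance Definable.forcesEq {p x y : E → ZFSet.{u}} [hp : SetTerm 𝓜 p] [hx : SetTerm 𝓜 x]
    [hy : SetTerm 𝓜 y] : Definable 𝓜 (fun e => ForcesEq S (p e) (x e) (y e)) := by
  obtain ⟨R, hR, h⟩ := exists_forcesEq_class 𝓜 S
  have : IsClass 𝓜 R := ⟨hR⟩
  exact .congr (fun e => pair (p e) (pair (x e) (y e)) ∈ R) fun e =>
    (h _ (hp.mem_sets e) _ (hx.mem_sets e) _ (hy.mem_sets e)).symm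

instance Definable.forcesMem {p x y : E → ZFSet.{u}} [hp : SetTerm 𝓜 p] [hx : SetTerm 𝓜 x]
    [hy : ClassTerm 𝓜 y] : Definable 𝓜 (fun e => ForcesMem S (p e) (x e) (y e)) := by
  have := (hp.comp (.fstSet (E := E))).comp (.fstSet (E := E × 𝓜.sets))
  have := (hx.comp (.fstSet (E := E))).comp (.fstSet (E := E × 𝓜.sets))
  exact .congr (fun e => ∃ y' t, pair y' t ∈ y e ∧ S.Ext (p e) t ∧ ForcesEq S (p e) (x e) y')
    fun _ => Iff.rfl

instance Definable.forcesSub {p x y : E → ZFSet.{u}} [hp : SetTerm 𝓜 p] [hx : ClassTerm 𝓜 x]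
    [hy : ClassTerm 𝓜 y] : Definable 𝓜 (fun e => ForcesSub S (p e) (x e) (y e)) := by
  have := hx.comp (.fstSet (E := E))
  have := (((hy.comp (.fstSet (E := E))).comp (.fstSet (E := E × 𝓜.sets))).comp
    (.fstSet (E := (E × 𝓜.sets) × 𝓜.sets))).comp (.fstSet (E := ((E × 𝓜.sets) × 𝓜.sets) × 𝓜.sets))
  exact .congr (fun e => ∀ q, S.Ext q (p e) → ∀ x' s, pair x' s ∈ x e → S.Ext q s →
    ∃ r, S.Ext r q ∧ ForcesMem S r x' (y e)) fun _ => Iff.rfl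

instance Definable.forcesEqClass {p x y : E → ZFSet.{u}} [hp : SetTerm 𝓜 p] [hx : ClassTerm 𝓜 x]
    [hy : ClassTerm 𝓜 y] : Definable 𝓜 (fun e => ForcesEq S (p e) (x e) (y e)) :=
  .congr (fun e => ForcesSub S (p e) (x e) (y e) ∧ ForcesSub S (p e) (y e) (x e))
    fun _ => forcesEq_iff

end ExtInstances

/-! ### The truth lemma for atomic formulas -/

section Supported

/-- The property `Q` of automorphisms holds on some group of the base of the filter. -/
def Supported (S : SystemData.{u}) (Q : S.Aut → Prop) : Prop :=
  ∃ a, S.InDomF a ∧ ∀ d, pair a d ∈ S.cF → Q (S.permOf d)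

variable {𝓜 : ClassModel.{u}} {S : SystemData.{u}} [hS : Fact (IsSymmetricSystem 𝓜 S)]

variable (𝓜) in
include hS in
theorem Supported.and {Q R : S.Aut → Prop} (hQ : Supported S Q) (hR : Supported S R) :
    Supported S (fun π => Q π ∧ R π) := by
  obtain ⟨a, ha, hQ⟩ := hQ
  obtain ⟨b, hb, hR⟩ := hR
  obtain ⟨c, hc, h⟩ := hS.out.inter_mem a b ha hb
  refine ⟨c, hc, fun d hd => ?_⟩
  obtain ⟨h1, h2⟩ := h ((mem_baseGroup 𝓜).2 ⟨d, hd, rfl⟩)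
  obtain ⟨d1, hd1, e1⟩ := (mem_baseGroup 𝓜).1 h1
  obtain ⟨d2, hd2, e2⟩ := (mem_baseGroup 𝓜).1 h2
  exact ⟨e1 ▸ hQ d1 hd1, e2 ▸ hR d2 hd2⟩

variable (𝓜) in
include hS in
theorem Supported.forall_fin {n : ℕ} {Q : Fin n → S.Aut → Prop} (hQ : ∀ i, Supported S (Q i)) :
    Supported S (fun π => ∀ i, Q i π) := by
  induction n with
  | zero =>
    -- the base of the filter is not empty
    obtain ⟨b, hb, -⟩ := hS.out.top_mem
    exact ⟨b, hb, fun _ _ i => i.elim0⟩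
  | succ n ih =>
    obtain ⟨a, ha, h⟩ := (hQ 0).and 𝓜 (ih fun i => hQ i.succ)
    exact ⟨a, ha, fun d hd i => Fin.cases (h d hd).1 (h d hd).2 i⟩

theorem IsHSName.supported {x : ZFSet.{u}} (h : IsHSName 𝓜 S x) :
    Supported S (fun π => act π x = x) := h.exists_base

omit hS in
theorem IsHSName.act_inv_eq {x : ZFSet.{u}} (h : IsHSName 𝓜 S x) {π : S.Aut} (hπ : act π x = x) :
    act π⁻¹ x = x := by
  nth_rw 1 [← hπ]
  exact act_inv_act h.isName π

omit hS in
theorem IsFilter.upward_ext {G : Set ZFSet.{u}} (hG : IsFilter S G) {p q : ZFSet.{u}} (hp : p ∈ G)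
    (hq : q ∈ S.P) (h : S.Ext p q) : q ∈ G :=
  hG.upward ⟨p, hG.sub p hp⟩ ⟨q, hq⟩ hp h

omit hS in
theorem IsFilter.directed_ext {G : Set ZFSet.{u}} (hG : IsFilter S G) {p q : ZFSet.{u}}
    (hp : p ∈ G) (hq : q ∈ G) : ∃ r ∈ G, S.Ext r p ∧ S.Ext r q := by
  obtain ⟨r, hr, h⟩ := hG.directed ⟨p, hG.sub p hp⟩ ⟨q, hG.sub q hq⟩ hp hq
  exact ⟨r.1, hr, h⟩

/-- A generic filter decides every definable property of conditions that is preserved by a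
symmetric group of automorphisms. -/
theorem IsGeneric.decides [KelleyMorse 𝓜] {G : Set ZFSet.{u}} (hG : IsGeneric 𝓜 S G)
    (Q : ZFSet.{u} → Prop)
    [Definable 𝓜 (fun e : EmptyEnv.{u} × 𝓜.sets => Q e.2.1)] {K : S.Aut → Prop}
    (hK : Supported S K) (inv : ∀ π, K π → K π⁻¹)
    (hQ : ∀ π ∈ S.group, K π → ∀ p : S.Cond, Q p.1 → Q (π p).1) :
    ∃ r ∈ G, Q r ∨ ∀ q, S.Ext q r → ¬ Q q := by
  obtain ⟨a, ha, h⟩ := hK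
  obtain ⟨r, hr, hrQ⟩ := hG.exists_decides Q ha fun d hd p => by
    have hd' := (mem_group 𝓜).2 ⟨d, inDomG_of_pair_mem_cF 𝓜 hd, rfl⟩
    refine ⟨hQ _ hd' (h d hd) p, fun hp => ?_⟩
    simpa using hQ _ (inv_mem_group 𝓜 hd') (inv _ (h d hd)) _ hp
  exact ⟨r.1, hr, hrQ.imp_right fun h q hq => h ⟨q, (ext_mem 𝓜 hq).1⟩ hq⟩

end Supported

section AtomicTruth

variable {𝓜 : ClassModel.{u}} [KelleyMorse 𝓜] {S : SystemData.{u}}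
  [hS : Fact (IsSymmetricSystem 𝓜 S)] {G : Set ZFSet.{u}}

omit [KelleyMorse 𝓜] in
theorem forcesMem_of_eval_mem (hG : IsGeneric 𝓜 S G) {x y : ZFSet.{u}}
    (ih : ∀ y' t, pair y' t ∈ y → eval G x = eval G y' → ∃ p ∈ G, ForcesEq S p x y')
    (h : eval G x ∈ eval G y) : ∃ p ∈ G, ForcesMem S p x y := by
  obtain ⟨y', t, ht, hy, e⟩ := mem_eval.1 h
  obtain ⟨p, hp, h⟩ := ih y' t hy e
  obtain ⟨r, hr, hrt, hrp⟩ := hG.filter.directed_ext ht hp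
  exact ⟨r, hr, y', t, hy, hrt, h.mono 𝓜 hrp⟩

omit [KelleyMorse 𝓜] in
theorem eval_mem_of_forcesMem (hG : IsGeneric 𝓜 S G) {x y p : ZFSet.{u}}
    (ih : ∀ y' t, pair y' t ∈ y → ∀ p ∈ G, ForcesEq S p x y' → eval G x = eval G y')
    (hp : p ∈ G) (h : ForcesMem S p x y) : eval G x ∈ eval G y := by
  obtain ⟨y', t, hy, ht, h⟩ := h
  exact mem_eval.2 ⟨y', t, hG.filter.upward_ext hp (ext_mem 𝓜 ht).2 ht, hy, ih y' t hy p hp h⟩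

theorem eval_subset_iff (hG : IsGeneric 𝓜 S G) {x y : ZFSet.{u}} (hx : x ∈ 𝓜.classes)
    (hy : y ∈ 𝓜.classes) (hxn : IsHSName 𝓜 S x) (hyn : IsHSName 𝓜 S y)
    (ih : ∀ x' s, pair x' s ∈ x → ∀ y' t, pair y' t ∈ y →
      (eval G x' = eval G y' ↔ ∃ p ∈ G, ForcesEq S p x' y')) :
    eval G x ⊆ eval G y ↔ ∃ p ∈ G, ForcesSub S p x y := by
  have : IsClass 𝓜 x := ⟨hx⟩
  have : IsClass 𝓜 y := ⟨hy⟩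
  constructor
  · intro hsub
    -- a condition in `G` keeps an element of `x` out of `y`, or one in `G` forces `x ⊆ y`
    obtain ⟨r, hr, ⟨x', s, hx', hs, h⟩ | h⟩ := hG.decides
      (fun q => ∃ x' s, pair x' s ∈ x ∧ S.Ext q s ∧ ∀ r, S.Ext r q → ¬ ForcesMem S r x' y)
      (hxn.supported.and 𝓜 hyn.supported)
      (fun π h => ⟨hxn.act_inv_eq h.1, hyn.act_inv_eq h.2⟩) (by
        rintro π - ⟨hπx, hπy⟩ q ⟨x', s, hx', hs, h⟩
        have hsP := (ext_mem 𝓜 hs).2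
        refine ⟨act π x', (π ⟨s, hsP⟩).1, hπx ▸ pair_mem_act (p := ⟨s, hsP⟩) π hx',
          (ext_map π (p := ⟨s, hsP⟩)).2 hs, fun r hr hF => ?_⟩
        obtain ⟨r', hr'⟩ := π.surjective ⟨r, (ext_mem 𝓜 hr).1⟩
        obtain rfl : (π r').1 = r := congrArg Subtype.val hr'
        refine h r'.1 ((ext_map π).1 hr) ?_
        have := forcesMem_act 𝓜 π⁻¹ hF
        rwa [act_inv_act (hxn.isName.of_pair_mem hx').1, hyn.act_inv_eq hπy,
          RelIso.inv_apply_self] at this)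
    · have hsG := hG.filter.upward_ext hr (ext_mem 𝓜 hs).2 hs
      obtain ⟨p, hp, hF⟩ := forcesMem_of_eval_mem hG
        (fun y' t hy' => (ih x' s hx' y' t hy').1) (hsub (mem_eval.2 ⟨x', s, hsG, hx', rfl⟩))
      obtain ⟨q, hq, hqp, hqr⟩ := hG.filter.directed_ext hp hr
      exact absurd (hF.mono 𝓜 hqp) (h q hqr)
    · refine ⟨r, hr, fun q hq x' s hx' hs => ?_⟩
      have := h q hq
      push Not at this
      exact this x' s hx' hs
  · rintro ⟨p, hp, h⟩ a ha
    obtain ⟨x', s, hs, hx', rfl⟩ := mem_eval.1 ha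
    have hx'n := hxn.of_pair_mem hx'
    have : IsSet 𝓜 x' := ⟨(of_pair_mem_sets (mem_sets_of_mem_class hx hx')).1⟩
    obtain ⟨r, hr, hF | hF⟩ := hG.decides (fun q => ForcesMem S q x' y)
      (hx'n.supported.and 𝓜 hyn.supported)
      (fun π h => ⟨hx'n.act_inv_eq h.1, hyn.act_inv_eq h.2⟩) (by
        rintro π - ⟨hπx, hπy⟩ q hF
        have := forcesMem_act 𝓜 π hF
        rwa [hπx, hπy] at this)
    · exact eval_mem_of_forcesMem hG
        (fun y' t hy' p hp hF => (ih x' s hx' y' t hy').2 ⟨p, hp, hF⟩) hr hF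
    · obtain ⟨q, hq, hqp, hqr⟩ := hG.filter.directed_ext hp hr
      obtain ⟨q', hq', hqq, hqs⟩ := hG.filter.directed_ext hq hs
      obtain ⟨r', hr', hF'⟩ := h q' (ext_trans 𝓜 hqq hqp) x' s hx' hqs
      exact absurd hF' (hF r' (ext_trans 𝓜 hr' (ext_trans 𝓜 hqq hqr)))

/-- The truth lemma for equality. -/
theorem eval_eq_iff (hG : IsGeneric 𝓜 S G) {x y : ZFSet.{u}} (hx : x ∈ 𝓜.classes)
    (hy : y ∈ 𝓜.classes) (hxn : IsHSName 𝓜 S x) (hyn : IsHSName 𝓜 S y) :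
    eval G x = eval G y ↔ ∃ p ∈ G, ForcesEq S p x y := by
  induction hr : x.rank using WellFoundedLT.induction generalizing x y with
  | ind r ih =>
    subst hr
    have ih' : ∀ x' s, pair x' s ∈ x → ∀ y' t, pair y' t ∈ y →
        (eval G x' = eval G y' ↔ ∃ p ∈ G, ForcesEq S p x' y') := fun x' s hx' y' t hy' =>
      ih _ (rank_lt_of_pair_mem hx')
        (sets_subset_classes (of_pair_mem_sets (mem_sets_of_mem_class hx hx')).1)
        (sets_subset_classes (of_pair_mem_sets (mem_sets_of_mem_class hy hy')).1) (hxn.of_pair_mem hx') (hyn.of_pair_mem hy')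
        rfl
    have h1 := eval_subset_iff hG hx hy hxn hyn ih'
    have h2 := eval_subset_iff hG hy hx hyn hxn fun y' t hy' x' s hx' => by
      rw [eq_comm, ih' x' s hx' y' t hy']
      simp only [forcesEq_comm]
    simp only [forcesEq_iff]
    constructor
    · intro h
      obtain ⟨p, hp, hF⟩ := h1.1 (h ▸ fun _ ha => ha)
      obtain ⟨q, hq, hF'⟩ := h2.1 (h ▸ fun _ ha => ha)
      obtain ⟨r, hr, hrp, hrq⟩ := hG.filter.directed_ext hp hq
      exact ⟨r, hr, hF.mono 𝓜 hrp, hF'.mono 𝓜 hrq⟩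
    · rintro ⟨p, hp, hF, hF'⟩
      exact ZFSet.ext fun a => ⟨fun ha => h1.2 ⟨p, hp, hF⟩ ha, fun ha => h2.2 ⟨p, hp, hF'⟩ ha⟩

/-- The truth lemma for membership. -/
theorem eval_mem_iff (hG : IsGeneric 𝓜 S G) {x Y : ZFSet.{u}} (hx : x ∈ 𝓜.classes)
    (hY : Y ∈ 𝓜.classes) (hxn : IsHSName 𝓜 S x) (hYn : IsHSName 𝓜 S Y) :
    eval G x ∈ eval G Y ↔ ∃ p ∈ G, ForcesMem S p x Y := by
  have key : ∀ y' t, pair y' t ∈ Y →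
      (eval G x = eval G y' ↔ ∃ p ∈ G, ForcesEq S p x y') := fun y' t hy' =>
    eval_eq_iff hG hx
      (sets_subset_classes (of_pair_mem_sets (mem_sets_of_mem_class hY hy')).1) hxn (hYn.of_pair_mem hy')
  exact ⟨forcesMem_of_eval_mem hG fun y' t hy' => (key y' t hy').1,
    fun ⟨p, hp, h⟩ => eval_mem_of_forcesMem hG
      (fun y' t hy' p hp hF => (key y' t hy').2 ⟨p, hp, hF⟩) hp h⟩

end AtomicTruth

/-! ### The forcing relation and the comprehension name -/

section Forcing

/-- The strong forcing relation `p ⊩ φ(x, X)` for second-order formulas; the quantifiers range over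
the hereditarily symmetric names in the model. -/
def Forces (𝓜 : ClassModel.{u}) (S : SystemData.{u}) : {n m : ℕ} → ClassFormula n m → ZFSet.{u} →
    (Fin n → ZFSet.{u}) → (Fin m → ZFSet.{u}) → Prop
  | _, _, .mem i j, p, x, _ => ForcesMem S p (x i) (x j)
  | _, _, .eq i j, p, x, _ => ForcesEq S p (x i) (x j)
  | _, _, .memClass i J, p, x, X => ForcesMem S p (x i) (X J)
  | _, _, .eqClass I J, p, _, X => ForcesEq S p (X I) (X J)
  | _, _, .and φ ψ, p, x, X => Forces 𝓜 S φ p x X ∧ Forces 𝓜 S ψ p x X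
  | _, _, .not φ, p, x, X => ∀ q, S.Ext q p → ¬ Forces 𝓜 S φ q x X
  | _, _, .exSet φ, p, x, X => ∃ a ∈ 𝓜.sets, IsHSName 𝓜 S a ∧
      Forces 𝓜 S φ p (Fin.snoc (α := fun _ => ZFSet.{u}) x a) X
  | _, _, .exClass φ, p, x, X => ∃ A ∈ 𝓜.classes, IsHSName 𝓜 S A ∧
      Forces 𝓜 S φ p x (Fin.snoc (α := fun _ => ZFSet.{u}) X A)

theorem map_snoc {n : ℕ} {α : Type v} (f : α → α) (x : Fin n → α) (a : α) :
    (fun i => f (Fin.snoc (α := fun _ => α) x a i)) =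
      Fin.snoc (α := fun _ => α) (fun i => f (x i)) (f a) := by
  funext i
  refine Fin.lastCases ?_ (fun j => ?_) i <;> simp

theorem forall_snoc {n : ℕ} {α : Type v} {P : α → Prop} {x : Fin n → α} {a : α}
    (hx : ∀ i, P (x i)) (ha : P a) (i : Fin (n + 1)) : P (Fin.snoc (α := fun _ => α) x a i) := by
  refine Fin.lastCases ?_ (fun j => ?_) i
  · simpa using ha
  · simpa using hx j

variable {𝓜 : ClassModel.{u}} [KelleyMorse 𝓜] {S : SystemData.{u}}
  [hS : Fact (IsSymmetricSystem 𝓜 S)]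

variable (𝓜) in
omit [KelleyMorse 𝓜] in
include hS in
theorem Forces.mono {n m : ℕ} {φ : ClassFormula n m} : ∀ {p q : ZFSet.{u}} {x : Fin n → ZFSet.{u}}
    {X : Fin m → ZFSet.{u}}, Forces 𝓜 S φ p x X → S.Ext q p → Forces 𝓜 S φ q x X := by
  induction φ with
  | mem i j => exact fun h hq => ForcesMem.mono 𝓜 h hq
  | eq i j => exact fun h hq => ForcesEq.mono 𝓜 h hq
  | memClass i J => exact fun h hq => ForcesMem.mono 𝓜 h hq
  | eqClass I J => exact fun h hq => ForcesEq.mono 𝓜 h hq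
  | and φ ψ h₁ h₂ => exact fun h hq => ⟨h₁ h.1 hq, h₂ h.2 hq⟩
  | not φ _ => exact fun h hq r hr => h r (ext_trans 𝓜 hr hq)
  | exSet φ ih => exact fun ⟨a, ha, hn, h⟩ hq => ⟨a, ha, hn, ih h hq⟩
  | exClass φ ih => exact fun ⟨a, ha, hn, h⟩ hq => ⟨a, ha, hn, ih h hq⟩

/-- Definability of the forcing relation. -/
theorem definable_forces {n m : ℕ} (φ : ClassFormula n m) : ∀ {E : Type (u + 1)} [Ctx 𝓜 E]
    (p : E → ZFSet.{u}) (x : Fin n → E → ZFSet.{u}) (X : Fin m → E → ZFSet.{u}), SetTerm 𝓜 p →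
    (∀ i, SetTerm 𝓜 (x i)) → (∀ j, ClassTerm 𝓜 (X j)) →
    Definable 𝓜 (fun e => Forces 𝓜 S φ (p e) (fun i => x i e) (fun j => X j e)) := by
  induction φ with
  | mem i j =>
    intro E _ p x X hp hx hX
    exact inferInstanceAs (Definable 𝓜 fun e => ForcesMem S (p e) (x i e) (x j e))
  | eq i j =>
    intro E _ p x X hp hx hX
    exact inferInstanceAs (Definable 𝓜 fun e => ForcesEq S (p e) (x i e) (x j e))
  | memClass i J =>
    intro E _ p x X hp hx hX
    exact inferInstanceAs (Definable 𝓜 fun e => ForcesMem S (p e) (x i e) (X J e))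
  | eqClass I J =>
    intro E _ p x X hp hx hX
    exact inferInstanceAs (Definable 𝓜 fun e => ForcesEq S (p e) (X I e) (X J e))
  | and φ ψ h₁ h₂ =>
    intro E _ p x X hp hx hX
    have := h₁ p x X hp hx hX
    have := h₂ p x X hp hx hX
    exact inferInstanceAs (Definable 𝓜 fun e => Forces 𝓜 S φ (p e) (fun i => x i e)
      (fun j => X j e) ∧ Forces 𝓜 S ψ (p e) (fun i => x i e) (fun j => X j e))
  | not φ ih =>
    intro E _ p x X hp hx hX
    have := ih (fun e : E × 𝓜.sets => e.2.1) (fun i e => x i e.1) (fun j e => X j e.1)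
      inferInstance (fun i => (hx i).comp .fstSet) (fun j => (hX j).comp .fstSet)
    exact inferInstanceAs (Definable 𝓜 fun e => ∀ q, S.Ext q (p e) →
      ¬ Forces 𝓜 S φ q (fun i => x i e) (fun j => X j e))
  | exSet φ ih =>
    intro E _ p x X hp hx hX
    have h := ih (fun e : E × 𝓜.sets => p e.1)
      (Fin.snoc (α := fun _ => E × 𝓜.sets → ZFSet.{u}) (fun i e => x i e.1) fun e => e.2.1)
      (fun j e => X j e.1) (hp.comp .fstSet)
      (forall_snoc (P := SetTerm 𝓜) (fun i => (hx i).comp .fstSet) inferInstance)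
      (fun j => (hX j).comp .fstSet)
    have : Definable 𝓜 fun e : E × 𝓜.sets => Forces 𝓜 S φ (p e.1)
        (Fin.snoc (α := fun _ => ZFSet.{u}) (fun i => x i e.1) e.2.1) (fun j => X j e.1) := by
      convert h using 3 with e
      funext i
      refine Fin.lastCases ?_ (fun j => ?_) i <;> simp
    exact inferInstanceAs (Definable 𝓜 fun e => ∃ a ∈ 𝓜.sets, IsHSName 𝓜 S a ∧
      Forces 𝓜 S φ (p e) (Fin.snoc (α := fun _ => ZFSet.{u}) (fun i => x i e) a) (fun j => X j e))
  | exClass φ ih =>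
    intro E _ p x X hp hx hX
    have h := ih (fun e : E × 𝓜.classes => p e.1) (fun i e => x i e.1)
      (Fin.snoc (α := fun _ => E × 𝓜.classes → ZFSet.{u}) (fun j e => X j e.1) fun e => e.2.1)
      (hp.comp .fstClass) (fun i => (hx i).comp .fstClass)
      (forall_snoc (P := ClassTerm 𝓜) (fun j => (hX j).comp .fstClass) inferInstance)
    have : Definable 𝓜 fun e : E × 𝓜.classes => Forces 𝓜 S φ (p e.1) (fun i => x i e.1)
        (Fin.snoc (α := fun _ => ZFSet.{u}) (fun j => X j e.1) e.2.1) := by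
      convert h using 3 with e
      funext i
      refine Fin.lastCases ?_ (fun j => ?_) i <;> simp
    exact inferInstanceAs (Definable 𝓜 fun e => ∃ A ∈ 𝓜.classes, IsHSName 𝓜 S A ∧
      Forces 𝓜 S φ (p e) (fun i => x i e) (Fin.snoc (α := fun _ => ZFSet.{u}) (fun j => X j e) A))

/-- The symmetry lemma: automorphisms in the group preserve the forcing relation. -/
theorem forces_act {n m : ℕ} {φ : ClassFormula n m} : ∀ {π : S.Aut} {p : S.Cond}
    {x : Fin n → ZFSet.{u}} {X : Fin m → ZFSet.{u}}, π ∈ S.group →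
    (∀ i, x i ∈ 𝓜.classes ∧ IsHSName 𝓜 S (x i)) → (∀ j, X j ∈ 𝓜.classes ∧ IsHSName 𝓜 S (X j)) →
    Forces 𝓜 S φ p.1 x X →
    Forces 𝓜 S φ (π p).1 (fun i => act π (x i)) (fun j => act π (X j)) := by
  induction φ with
  | mem i j => exact fun _ _ _ h => forcesMem_act 𝓜 _ h
  | eq i j => exact fun _ _ _ h => forcesEq_act 𝓜 _ h
  | memClass i J => exact fun _ _ _ h => forcesMem_act 𝓜 _ h
  | eqClass I J => exact fun _ _ _ h => forcesEq_act 𝓜 _ h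
  | and φ ψ h₁ h₂ => exact fun hπ hx hX h => ⟨h₁ hπ hx hX h.1, h₂ hπ hx hX h.2⟩
  | not φ ih =>
    intro π p x X hπ hx hX h q' hq hF
    obtain ⟨q, hq'⟩ := π.surjective ⟨q', (ext_mem 𝓜 hq).1⟩
    obtain rfl : (π q).1 = q' := congrArg Subtype.val hq'
    refine h q.1 ((ext_map π).1 hq) ?_
    have := ih (inv_mem_group 𝓜 hπ)
      (fun i => ⟨act_mem_classes hπ (hx i).1, isHSName_act hπ (hx i).1 (hx i).2⟩)
      (fun j => ⟨act_mem_classes hπ (hX j).1, isHSName_act hπ (hX j).1 (hX j).2⟩) hF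
    simpa only [RelIso.inv_apply_self, act_inv_act (hx _).2.isName,
      act_inv_act (hX _).2.isName] using this
  | exSet φ ih =>
    rintro π p x X hπ hx hX ⟨a, ha, hn, h⟩
    have := ih hπ (forall_snoc (P := fun a => a ∈ 𝓜.classes ∧ IsHSName 𝓜 S a) hx
      ⟨sets_subset_classes ha, hn⟩) hX h
    rw [map_snoc] at this
    exact ⟨_, act_mem_sets hπ ha, isHSName_act hπ (sets_subset_classes ha) hn, this⟩
  | exClass φ ih =>
    rintro π p x X hπ hx hX ⟨a, ha, hn, h⟩
    have := ih hπ hx (forall_snoc (P := fun a => a ∈ 𝓜.classes ∧ IsHSName 𝓜 S a) hX ⟨ha, hn⟩) h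
    rw [map_snoc] at this
    exact ⟨_, act_mem_classes hπ ha, isHSName_act hπ ha hn, this⟩

/-- The truth lemma: what holds in the symmetric extension is forced by a condition in the generic
filter. -/
theorem sat_iff_forces {G : Set ZFSet.{u}} (hG : IsGeneric 𝓜 S G) {n m : ℕ}
    {φ : ClassFormula n m} : ∀ {x : Fin n → ZFSet.{u}} {X : Fin m → ZFSet.{u}},
    (∀ i, x i ∈ 𝓜.sets ∧ IsHSName 𝓜 S (x i)) → (∀ j, X j ∈ 𝓜.classes ∧ IsHSName 𝓜 S (X j)) →
    (φ.Sat (symmetricExtension 𝓜 S G) (fun i => eval G (x i)) (fun j => eval G (X j)) ↔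
      ∃ p ∈ G, Forces 𝓜 S φ p x X) := by
  induction φ with
  | mem i j =>
    exact fun hx _ => eval_mem_iff hG (sets_subset_classes (hx i).1)
      (sets_subset_classes (hx j).1) (hx i).2 (hx j).2
  | eq i j =>
    exact fun hx _ => eval_eq_iff hG (sets_subset_classes (hx i).1)
      (sets_subset_classes (hx j).1) (hx i).2 (hx j).2
  | memClass i J =>
    exact fun hx hX => eval_mem_iff hG (sets_subset_classes (hx i).1)
      (hX J).1 (hx i).2 (hX J).2
  | eqClass I J =>
    exact fun _ hX => eval_eq_iff hG (hX I).1 (hX J).1 (hX I).2 (hX J).2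
  | and φ ψ h₁ h₂ =>
    intro x X hx hX
    simp only [ClassFormula.Sat, Forces, h₁ hx hX, h₂ hx hX]
    constructor
    · rintro ⟨⟨p, hp, hF⟩, q, hq, hF'⟩
      obtain ⟨r, hr, hrp, hrq⟩ := hG.filter.directed_ext hp hq
      exact ⟨r, hr, hF.mono 𝓜 hrp, hF'.mono 𝓜 hrq⟩
    · rintro ⟨p, hp, hF, hF'⟩
      exact ⟨⟨p, hp, hF⟩, p, hp, hF'⟩
  | not φ ih =>
    intro x X hx hX
    simp only [ClassFormula.Sat, Forces, ih hx hX]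
    constructor
    · intro h
      have hx' : ∀ i, IsSet 𝓜 (x i) := fun i => ⟨(hx i).1⟩
      have hX' : ∀ j, IsClass 𝓜 (X j) := fun j => ⟨(hX j).1⟩
      have : Definable 𝓜 fun e : EmptyEnv.{u} × 𝓜.sets => Forces 𝓜 S φ e.2.1 x X :=
        definable_forces φ _ (fun i _ => x i) (fun j _ => X j) inferInstance
          (fun i => inferInstance) (fun j => inferInstance)
      obtain ⟨r, hr, hF | hF⟩ := hG.decides (fun p => Forces 𝓜 S φ p x X)
        ((Supported.forall_fin 𝓜 fun i => (hx i).2.supported).and 𝓜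
          (Supported.forall_fin 𝓜 fun j => (hX j).2.supported))
        (fun π h => ⟨fun i => (hx i).2.act_inv_eq (h.1 i), fun j => (hX j).2.act_inv_eq (h.2 j)⟩)
        (fun π hπ h p hF => by
          have := forces_act hπ (fun i => ⟨sets_subset_classes (hx i).1, (hx i).2⟩) hX hF
          simpa only [h.1, h.2] using this)
      · exact absurd ⟨r, hr, hF⟩ h
      · exact ⟨r, hr, hF⟩
    · rintro ⟨p, hp, h⟩ ⟨q, hq, hF⟩
      obtain ⟨r, hr, hrp, hrq⟩ := hG.filter.directed_ext hp hq
      exact h r hrp (hF.mono 𝓜 hrq)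
  | exSet φ ih =>
    intro x X hx hX
    have key : ∀ a ∈ 𝓜.sets, IsHSName 𝓜 S a → _ := fun a ha hn =>
      ih (forall_snoc (P := fun a => a ∈ 𝓜.sets ∧ IsHSName 𝓜 S a) hx ⟨ha, hn⟩) hX
    simp only [map_snoc] at key
    constructor
    · rintro ⟨_, ⟨a, ha, hn, rfl⟩, h⟩
      obtain ⟨p, hp, hF⟩ := (key a ha hn).1 h
      exact ⟨p, hp, a, ha, hn, hF⟩
    · rintro ⟨p, hp, a, ha, hn, hF⟩
      exact ⟨_, ⟨a, ha, hn, rfl⟩, (key a ha hn).2 ⟨p, hp, hF⟩⟩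
  | exClass φ ih =>
    intro x X hx hX
    have key : ∀ a ∈ 𝓜.classes, IsHSName 𝓜 S a → _ := fun a ha hn =>
      ih hx (forall_snoc (P := fun a => a ∈ 𝓜.classes ∧ IsHSName 𝓜 S a) hX ⟨ha, hn⟩)
    simp only [map_snoc] at key
    constructor
    · rintro ⟨_, ⟨a, ha, hn, rfl⟩, h⟩
      obtain ⟨p, hp, hF⟩ := (key a ha hn).1 h
      exact ⟨p, hp, a, ha, hn, hF⟩
    · rintro ⟨p, hp, a, ha, hn, hF⟩
      exact ⟨_, ⟨a, ha, hn, rfl⟩, (key a ha hn).2 ⟨p, hp, hF⟩⟩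

variable (S) in
/-- The class of all `⟨x, p⟩` with `p ⊩ φ(x, X)` is a hereditarily symmetric name. -/
theorem exists_comprehension_name {m : ℕ} (φ : ClassFormula 1 m) {X : Fin m → ZFSet.{u}}
    (hX : ∀ j, X j ∈ 𝓜.classes ∧ IsHSName 𝓜 S (X j)) :
    ∃ Y ∈ 𝓜.classes, IsHSName 𝓜 S Y ∧ ∀ x p, pair x p ∈ Y ↔
      (x ∈ 𝓜.sets ∧ IsHSName 𝓜 S x) ∧ p ∈ S.P ∧ Forces 𝓜 S φ p (fun _ => x) X := by
  have hX' : ∀ j, IsClass 𝓜 (X j) := fun j => ⟨(hX j).1⟩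
  have : Definable 𝓜 fun e : ((EmptyEnv.{u} × 𝓜.sets) × 𝓜.sets) × 𝓜.sets =>
      Forces 𝓜 S φ e.2.1 (fun _ => e.1.2.1) X :=
    definable_forces φ (E := ((EmptyEnv.{u} × 𝓜.sets) × 𝓜.sets) × 𝓜.sets) _ (fun _ e => e.1.2.1) (fun j _ => X j) inferInstance
      (fun i => inferInstance) (fun j => inferInstance)
  obtain ⟨Y, hY, hYz⟩ := Definable.comprehension (𝓜 := 𝓜)
    (Q := fun (_ : EmptyEnv.{u}) z => ∃ x ∈ 𝓜.sets, ∃ p ∈ S.P, z = pair x p ∧ IsHSName 𝓜 S x ∧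
      Forces 𝓜 S φ p (fun _ => x) X) inferInstance Fin.elim0
  have hYp : ∀ x p, pair x p ∈ Y ↔
      (x ∈ 𝓜.sets ∧ IsHSName 𝓜 S x) ∧ p ∈ S.P ∧ Forces 𝓜 S φ p (fun _ => x) X := by
    intro x p
    rw [hYz]
    constructor
    · rintro ⟨-, x', hx, p', hp, e, hn, hF⟩
      obtain ⟨rfl, rfl⟩ := ZFSet.pair_inj.1 e
      exact ⟨⟨hx, hn⟩, hp, hF⟩
    · rintro ⟨⟨hx, hn⟩, hp, hF⟩
      exact ⟨pair_mem_sets hx (cond_mem_sets 𝓜 ⟨p, hp⟩), x, hx, p, hp, rfl, hn, hF⟩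
  refine ⟨Y, hY, (isHSName_iff 𝓜 S hY).2 ⟨fun z hz => ?_, ?_⟩, hYp⟩
  · obtain ⟨-, x, hx, p, hp, e, hn, -⟩ := (hYz z).1 hz
    exact ⟨x, hx, p, hp, e, hn⟩
  · obtain ⟨a, ha, h⟩ := Supported.forall_fin 𝓜 fun j => (hX j).2.supported
    have ha' := ha
    obtain ⟨d, hd⟩ := ha'
    refine ⟨a, (of_pair_mem_sets (mem_sets_of_mem_class hS.out.cF_class hd)).1, ha, ?_⟩
    -- by the symmetry lemma, `π` maps `Y` into itself as soon as it fixes the names `X j`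
    have key : ∀ π ∈ S.group, (∀ j, act π (X j) = X j) → ∀ z ∈ act π Y, z ∈ Y := by
      intro π hπ hπX z hz
      obtain ⟨x, p, hxp, rfl⟩ := mem_act.1 hz
      obtain ⟨⟨hx, hn⟩, hp, hF⟩ := (hYp _ _).1 hxp
      have := forces_act hπ (fun _ => ⟨sets_subset_classes hx, hn⟩) hX hF
      simp only [hπX] at this
      exact (hYp _ _).2 ⟨⟨act_mem_sets hπ hx, isHSName_act hπ (sets_subset_classes hx) hn⟩,
        (π p).2, this⟩
    intro d hd
    have hπ : S.permOf d ∈ S.group := (mem_group 𝓜).2 ⟨d, inDomG_of_pair_mem_cF 𝓜 hd, rfl⟩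
    refine ZFSet.ext fun z => ⟨key _ hπ (h d hd) z, fun hz => ?_⟩
    obtain ⟨-, x, hx, p, hp, rfl, hn, hF⟩ := (hYz z).1 hz
    have := key _ (inv_mem_group 𝓜 hπ) (fun j => (hX j).2.act_inv_eq (h d hd j)) _
      (pair_mem_act (p := ⟨p, hp⟩) _ hz)
    have := pair_mem_act (S.permOf d) this
    rwa [← act_mul, mul_inv_cancel, act_one hn.isName, RelIso.apply_inv_self] at this

end Forcing

end ClassForcing

/-- If a transitive model of Gödel-Bernays set theory satisfies second-order class comprehension,
then so does every symmetric extension of it by a generic filter for a class symmetric system. -/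
theorem mainTheorem9 (𝓜 : ClassForcing.ClassModel) (hGB : 𝓜.SatisfiesGB)
    (htrans : 𝓜.IsTransitive) (S : ClassForcing.SystemData)
    (hS : ClassForcing.IsSymmetricSystem 𝓜 S) (hcomp : 𝓜.SecondOrderComprehension)
    (G : Set ZFSet) (hG : ClassForcing.IsGeneric 𝓜 S G) :
    (ClassForcing.symmetricExtension 𝓜 S G).SecondOrderComprehension := by
  have : ClassForcing.KelleyMorse 𝓜 := ⟨hGB, htrans, hcomp⟩
  have : Fact (ClassForcing.IsSymmetricSystem 𝓜 S) := ⟨hS⟩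
  intro m φ A hA
  choose X hX hXn hXA using hA
  obtain rfl : A = fun j => ClassForcing.eval G (X j) := funext hXA
  obtain ⟨Y, hY, hYn, hYp⟩ :=
    ClassForcing.exists_comprehension_name S φ fun j => ⟨hX j, hXn j⟩
  refine ⟨ClassForcing.eval G Y, ⟨Y, hY, hYn, rfl⟩, ?_⟩
  rintro _ ⟨x, hx, hxn, rfl⟩
  have key := fun {x : ZFSet} (hx : x ∈ 𝓜.sets ∧ ClassForcing.IsHSName 𝓜 S x) =>
    ClassForcing.sat_iff_forces hG (φ := φ) (x := fun _ => x) (fun _ => hx)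
      fun j => ⟨hX j, hXn j⟩
  rw [ClassForcing.mem_eval]
  constructor
  · rintro ⟨y, p, hp, hyp, e⟩
    obtain ⟨hy, -, hF⟩ := (hYp y p).1 hyp
    rw [e]
    exact (key hy).2 ⟨p, hp, hF⟩
  · intro h
    obtain ⟨p, hp, hF⟩ := (key ⟨hx, hxn⟩).1 h
    exact ⟨x, p, hp, (hYp x p).2 ⟨⟨hx, hxn⟩, hG.filter.sub p hp, hF⟩, rfl⟩
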